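/- Let $a\in\mathbb R$ with $a^2>2$, put $\xi=1-a^2$, and let $H_n(t)=(-1)^ne^{t^2}\frac{d^n}{dt^n}e^{-t^2}$ be the Hermite polynomials. Define $$W_{a,\xi}(t)=e^{-t^2}\begin{pmatrix}1&at\\0&1\end{pmatrix}\begin{pmatrix}\xi&0\\0&1\end{pmatrix}\begin{pmatrix}1&0\\at&1\end{pmatrix},\qquad P_n(t)=P_{n,a,\xi}(t)=H_n(t)\begin{pmatrix}1&0\\0&\xi\end{pmatrix}+nH_{n-1}(t)\begin{pmatrix}0&-a\\-a&a^2t\end{pmatrix},\quad n\ge 0 ,$$ so that $P_1(t)=\begin{pmatrix}2t&-a\\-a&(2-a^2)t\end{pmatrix}$; put $\mathfrak p(t)=\det P_1(t)=2(2-a^2)t^2-a^2$ and $$\mathcal P_n=\mathcal A(P_n),\qquad \mathcal A(y)=-y+y'\,(P_1')^{-1}P_1 ,$$ $$\mathcal W_a(t)=\frac{e^{-t^2}}{\mathfrak p(t)^2}\begin{pmatrix}\frac{a^2}{4(a^2-2)}\mathfrak p(t)^2+\frac{\mathfrak p(t)}{a^2-2}-a^2& a\left(\frac{\mathfrak p(t)}{a^2-2}-2\right)t\\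 a\left(\frac{\mathfrak p(t)}{a^2-2}-2\right)t&\frac{2(a^2(a^2-2)-\mathfrak p(t))}{(a^2-2)^2}\end{pmatrix}.$$ For a symmetric matrix function $W$ with finite moments write $\langle P,Q\rangle_W=\int_{\mathbb R}P(t)W(t)Q(t)^*\,dt$ and $\|P\|_W^2=\langle P,P\rangle_W$. Then: 1. $\mathfrak p(t)\ne0$ and $\mathcal W_a(t)$ is positive definite for every $t\in\mathbb R$, and $\mathcal W_a(t)\,dt$ is a weight matrix: all its moments are finite, $\int_\Omega\mathcal W_a(t)\,dt$ is positive semidefinite for every Borel set $\Omega$, and positive definite for at least one. 2. The $\mathcal P_n$, $n\in\mathbb N\setminus\{1\}$, are exceptional matrix polynomials with respect to $\mathcal W_a$, with gap $\{1\}$. That is: - for $n\ne 1$, $\mathcal P_n$ is a matrix polynomial of degree $n$ with nonsingular leading coefficient; - $\langle\mathcal P_n,\mathcal P_k\rangle_{\mathcal W_a}=0$ for $n\ne k$, $n,k\ne1$, and $\|\mathcal P_n\|^2_{\mathcal W_a}$ is positive definite for $n\neq 1$; - the linear span $\{\sum_{n\in s}A_n\mathcal P_n: s\subset\mathbb N\setminus\{1\}\text{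 finite},\ A_n\in\mathbb R^{2\times2}\}$ is dense in $L^2(\mathcal W_a)$, the space of Borel measurable $f:\mathbb R\to\mathbb R^{2\times 2}$ with $\int\operatorname{tr}(f\,\mathcal W_a f^*)\,dt<\infty$, with the square root of this integral as norm; - there are $2\times2$ matrices $\mathcal F_2\ne0,\mathcal F_1,\mathcal F_0$ of rational functions and, for each $n\ne1$, a matrix $\Gamma_n\in\mathbb R^{2\times2}$, such that $\mathcal P_n''\mathcal F_2+\mathcal P_n'\mathcal F_1+\mathcal P_n\mathcal F_0=\Gamma_n\mathcal P_n$. 3. For $n\ne1$, $$\|\mathcal P_n\|^2_{\mathcal W_a}=\frac{n-1}{2(a^2-2)}\begin{pmatrix}1&0\\0&-\frac2{a^2-2}\end{pmatrix}\|P_n\|^2_{W_{a,\xi}},$$ where for all $n\ge 0$ $$\|P_n\|^2_{W_{a,\xi}}=\sqrt\pi\,2^n\,n!\begin{pmatrix}\xi+\frac{a^2(n+1)}2&0\\0&\xi\left(\xi+\frac{a^2n}2\right)\end{pmatrix}.$$ -/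

import Mathlib

open scoped Polynomial Matrix ENNReal

noncomputable section

namespace ExcMat

/-! ### Matrix polynomials, weight matrices, exceptional matrix polynomials -/

/-- Real matrix polynomials of size `N × N`, as matrices with polynomial entries. -/
abbrev MatPoly (N : ℕ) := Matrix (Fin N) (Fin N) ℝ[X]

variable {N : ℕ}

/-- The value `P(t)`. -/
def evalAt (P : MatPoly N) (t : ℝ) : Matrix (Fin N) (Fin N) ℝ :=
  P.map (fun p => p.eval t)

/-- The derivative `P'`, entry by entry. -/
def der (P : MatPoly N) : MatPoly N :=
  P.map (fun p => Polynomial.derivative p)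

/-- A real matrix, seen as a constant matrix polynomial. -/
def const (A : Matrix (Fin N) (Fin N) ℝ) : MatPoly N :=
  A.map (fun x => Polynomial.C x)

/-- `P` has degree (at most, hence for `N > 0` exactly) `n`, and its coefficient of `t ^ n` is a
nonsingular matrix. -/
def HasDegreeNonsingular (P : MatPoly N) (n : ℕ) : Prop :=
  (∀ i j, (P i j).natDegree ≤ n) ∧ (P.map (fun p => p.coeff n)).det ≠ 0

/-- The matrix `W(Ω) = ∫_Ω W(t) dt`. -/
def mass (W : ℝ → Matrix (Fin N) (Fin N) ℝ) (Ω : Set ℝ) : Matrix (Fin N) (Fin N) ℝ :=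
  Matrix.of fun i j => ∫ t in Ω, W t i j

/-- The matrix of measures `W(t) dt` is a weight matrix: all its moments are finite, `W(Ω)` is
positive semidefinite for every Borel set `Ω`, and positive definite for at least one. -/
structure IsWeightMatrix (W : ℝ → Matrix (Fin N) (Fin N) ℝ) : Prop where
  moments : ∀ (k : ℕ) (i j : Fin N), MeasureTheory.Integrable (fun t : ℝ => t ^ k * W t i j)
  posSemidef : ∀ Ω : Set ℝ, MeasurableSet Ω → (mass W Ω).PosSemidef
  posDef : ∃ Ω : Set ℝ, MeasurableSet Ω ∧ (mass W Ω).PosDef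

/-- The matrix-valued form `⟨P, Q⟩_W = ∫ P(t) W(t) Q(t)^* dt`; the matrices are real, so that the
adjoint is the transpose. -/
def form (W : ℝ → Matrix (Fin N) (Fin N) ℝ) (P Q : MatPoly N) : Matrix (Fin N) (Fin N) ℝ :=
  Matrix.of fun i j => ∫ t : ℝ, (evalAt P t * W t * (evalAt Q t)ᵀ) i j

/-- The squared norm `∫ tr (f(t) W(t) f(t)^*) dt` of `L²(W)`, for a weight matrix `W(t) dt` (the
integrand is then nonnegative almost everywhere). -/
def normSq (W : ℝ → Matrix (Fin N) (Fin N) ℝ) (f : ℝ → Matrix (Fin N) (Fin N) ℝ) : ℝ≥0∞ :=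
  ∫⁻ t : ℝ, ENNReal.ofReal (f t * W t * (f t)ᵀ).trace

/-- `f` (a representative of a class) belongs to `L²(W)`. -/
def MemLTwo (W : ℝ → Matrix (Fin N) (Fin N) ℝ) (f : ℝ → Matrix (Fin N) (Fin N) ℝ) : Prop :=
  (∀ i j, Measurable fun t => f t i j) ∧ normSq W f < ∞

/-- `Q` lies in the linear span of the `P n`, `n ∉ X`: it is a finite sum `∑ A_n P_n` with real
matrices `A_n` multiplying on the left. -/
def InSpan (X : Finset ℕ) (P : ℕ → MatPoly N) (Q : MatPoly N) : Prop :=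
  ∃ (s : Finset ℕ) (A : ℕ → Matrix (Fin N) (Fin N) ℝ),
    Disjoint s X ∧ Q = ∑ n ∈ s, const (A n) * P n

/-- The linear span of the `P n`, `n ∉ X`, is dense in `L²(W)`. -/
def IsCompleteSystem (X : Finset ℕ) (P : ℕ → MatPoly N)
    (W : ℝ → Matrix (Fin N) (Fin N) ℝ) : Prop :=
  ∀ f : ℝ → Matrix (Fin N) (Fin N) ℝ, MemLTwo W f → ∀ ε : ℝ≥0∞, 0 < ε →
    ∃ Q : MatPoly N, InSpan X P Q ∧ normSq W (fun t => f t - evalAt Q t) < ε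

/-- Matrix polynomials seen as matrices of rational functions. -/
def toRat (P : MatPoly N) : Matrix (Fin N) (Fin N) (RatFunc ℝ) :=
  P.map (algebraMap ℝ[X] (RatFunc ℝ))

/-- The right-hand side differential operator `y ↦ y'' F₂ + y' F₁ + y F₀` whose coefficients are
matrices of rational functions. -/
def diffOp (F₂ F₁ F₀ : Matrix (Fin N) (Fin N) (RatFunc ℝ)) (Y : MatPoly N) :
    Matrix (Fin N) (Fin N) (RatFunc ℝ) :=
  toRat (der (der Y)) * F₂ + toRat (der Y) * F₁ + toRat Y * F₀

/-- The matrix polynomials `P n`, `n ∉ X`, are exceptional with respect to the weight matrix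
`W(t) dt`, with gaps at the degrees in `X`. (The values `P n` with `n ∈ X` play no role.) -/
structure IsExceptional (X : Finset ℕ) (P : ℕ → MatPoly N)
    (W : ℝ → Matrix (Fin N) (Fin N) ℝ) : Prop where
  degree : ∀ n ∉ X, HasDegreeNonsingular (P n) n
  weight : IsWeightMatrix W
  orthogonal : ∀ n ∉ X, ∀ k ∉ X, n ≠ k → form W (P n) (P k) = 0
  norm_posDef : ∀ n ∉ X, (form W (P n) (P n)).PosDef
  complete : IsCompleteSystem X P W
  eigen : ∃ F₂ F₁ F₀ : Matrix (Fin N) (Fin N) (RatFunc ℝ), F₂ ≠ 0 ∧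
    ∀ n ∉ X, ∃ Γ : Matrix (Fin N) (Fin N) ℝ,
      diffOp F₂ F₁ F₀ (P n) = toRat (const Γ) * toRat (P n)

/-- The first order operator `𝒜(Y) = -Y + Y' (P')⁻¹ P` of the quasi-Darboux transformation with
seed `P`, for a seed whose derivative `P'` is invertible over the ring of polynomials. -/
def quasiDarboux (P Y : MatPoly N) : MatPoly N :=
  -Y + der Y * (der P)⁻¹ * P

/-- Pointwise, `quasiDarboux` is the operator on functions, with inverses of real matrices. -/
theorem evalAt_quasiDarboux (P Y : MatPoly N) (h : IsUnit (der P).det) (t : ℝ) :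
    evalAt (quasiDarboux P Y) t =
      -evalAt Y t + evalAt (der Y) t * (evalAt (der P) t)⁻¹ * evalAt P t := by
  have key : ∀ M : MatPoly N, evalAt M t = (Polynomial.evalRingHom t).mapMatrix M :=
    fun M => rfl
  have hinv : evalAt (der P)⁻¹ t = (evalAt (der P) t)⁻¹ := by
    symm
    apply Matrix.inv_eq_left_inv
    rw [key, key, ← map_mul, Matrix.nonsing_inv_mul _ h, map_one]
  rw [← hinv]
  simp only [key, quasiDarboux, map_add, map_neg, map_mul]

/-! ### The Hermite type example -/

/-- The (physicists') Hermite polynomials. -/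
def H : ℕ → ℝ[X]
  | 0 => 1
  | n + 1 => 2 * Polynomial.X * H n - Polynomial.derivative (H n)

/-- The Rodrigues formula. -/
theorem H_eval (n : ℕ) : ∀ t : ℝ, (H n).eval t =
    (-1) ^ n * Real.exp (t ^ 2) * iteratedDeriv n (fun s : ℝ => Real.exp (-s ^ 2)) t := by
  suffices h : ∀ t : ℝ, iteratedDeriv n (fun s : ℝ => Real.exp (-s ^ 2)) t =
      (-1) ^ n * ((H n).eval t * Real.exp (-t ^ 2)) by
    intro t
    have h1 : Real.exp (t ^ 2) * Real.exp (-t ^ 2) = 1 := by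
      rw [← Real.exp_add]; simp
    have h2 : ((-1 : ℝ) ^ n) * (-1) ^ n = 1 := by
      rw [← mul_pow]; simp
    rw [h t]
    calc (H n).eval t = (H n).eval t * (((-1 : ℝ) ^ n) * (-1) ^ n)
          * (Real.exp (t ^ 2) * Real.exp (-t ^ 2)) := by rw [h1, h2]; ring
      _ = _ := by ring
  induction n with
  | zero => intro t; simp [H]
  | succ n ih =>
    intro t
    rw [iteratedDeriv_succ, funext ih]
    have hE : HasDerivAt (fun s : ℝ => Real.exp (-s ^ 2))
        (Real.exp (-t ^ 2) * (-(2 * t))) t := by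
      have := ((hasDerivAt_pow 2 t).neg).exp
      simpa using this
    have := ((((H n).hasDerivAt t).mul hE).const_mul ((-1 : ℝ) ^ n)).deriv
    refine Eq.trans this ?_
    simp [H, pow_succ]
    ring

/-- The signed weight `e^{-t²} (1, at; 0, 1) diag(ξ, 1) (1, 0; at, 1)`. -/
def hermiteWeight (a ξ t : ℝ) : Matrix (Fin 2) (Fin 2) ℝ :=
  Real.exp (-t ^ 2) • (!![1, a * t; 0, 1] * !![ξ, 0; 0, 1] * !![1, 0; a * t, 1])

/-- `P_{n,a,ξ} = H_n diag(1, ξ) + n H_{n-1} (0, -a; -a, a² t)`. -/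
def hermitePoly (a ξ : ℝ) (n : ℕ) : MatPoly 2 :=
  H n • const !![1, 0; 0, ξ] +
    ((n : ℝ[X]) * H (n - 1)) •
      !![0, -Polynomial.C a; -Polynomial.C a, Polynomial.C (a ^ 2) * Polynomial.X]

/-- The seed `P_{1,a,1-a²}`. -/
def seed (a : ℝ) : MatPoly 2 := hermitePoly a (1 - a ^ 2) 1

theorem seed_eq (a : ℝ) : seed a =
    !![2 * Polynomial.X, -Polynomial.C a;
      -Polynomial.C a, Polynomial.C (2 - a ^ 2) * Polynomial.X] := by
  ext i j : 1
  fin_cases i <;> fin_cases j <;> simp [seed, hermitePoly, H, const]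
  rw [← Polynomial.C_ofNat]
  simp only [map_ofNat]
  ring

/-- The derivative of the seed is invertible over the polynomials, so that `𝒜` is genuine. -/
theorem isUnit_det_der_seed (a : ℝ) (ha : 2 < a ^ 2) : IsUnit (der (seed a)).det := by
  have h : (der (seed a)).det = Polynomial.C (2 * (2 - a ^ 2)) := by
    rw [seed_eq, Matrix.det_fin_two]
    simp only [der, Matrix.map_apply, Matrix.of_apply, Matrix.cons_val, Matrix.cons_val_zero,
      Matrix.cons_val_one, Polynomial.derivative_mul, Polynomial.derivative_C,
      Polynomial.derivative_neg, Polynomial.derivative_X, Polynomial.derivative_ofNat,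
      Polynomial.C_mul, map_ofNat]
    ring
  rw [h, Polynomial.isUnit_C]
  exact (mul_ne_zero two_ne_zero (by linarith)).isUnit

/-- `𝒫_n = 𝒜(P_{n,a,1-a²})`. -/
def excPoly (a : ℝ) (n : ℕ) : MatPoly 2 :=
  quasiDarboux (seed a) (hermitePoly a (1 - a ^ 2) n)

/-- The scalar polynomial `𝔭 = det P_{1,a,1-a²}`. -/
def pfrak (a : ℝ) : ℝ[X] := (seed a).det

theorem pfrak_eval (a t : ℝ) : (pfrak a).eval t = 2 * (2 - a ^ 2) * t ^ 2 - a ^ 2 := by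
  rw [pfrak, seed_eq, Matrix.det_fin_two]
  simp
  ring

/-- The weight `𝒲_a(t)`. -/
def excWeight (a t : ℝ) : Matrix (Fin 2) (Fin 2) ℝ :=
  let p : ℝ := (pfrak a).eval t
  (Real.exp (-t ^ 2) / p ^ 2) •
    !![a ^ 2 / (4 * (a ^ 2 - 2)) * p ^ 2 + p / (a ^ 2 - 2) - a ^ 2,
        a * (p / (a ^ 2 - 2) - 2) * t;
      a * (p / (a ^ 2 - 2) - 2) * t,
        2 * (a ^ 2 * (a ^ 2 - 2) - p) / (a ^ 2 - 2) ^ 2]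

end ExcMat

end

noncomputable section

namespace ExcMat

variable {N : ℕ}

/-! ### Evaluation and differentiation of matrix polynomials -/

/-! Write `S` for the seed and `F = (S')⁻¹ S`. Since `S'` is a constant matrix, `F' = 1`, the
transformation is `𝒜(Y) = Y' F - Y`, and `(𝒜 Y)' = Y'' F`. The proof is a Darboux transformation:
`𝒜` has a partner `ℬ(Q) = Q D - Q' K / 𝔭`, with `D = eigenDiag a` and `K = adjCoeff a`, such that
`ℬ(𝒜(P_n)) = (n - 1) D P_n`. This is the second order equation of the `P_n`, and the denominator
disappears because `F K` is divisible by `𝔭` (`darbouxFactor_mul_adjCoeff`, `adjoint_excPoly`). As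
`𝒜` commutes with constant left factors, applying it once more gives `𝒜(ℬ(𝒫_n)) = (n - 1) D 𝒫_n`,
the required differential equation with rational coefficients.

The weights are linked by `F 𝒲 = W Kᵀ / 𝔭` and `(W Kᵀ / 𝔭)' + 𝒲 = -W D` (`darbouxFactor_mul_excNum`,
`pearson_excNum`). These make `ℬ` the adjoint of `𝒜`: `⟨𝒜 Y, Q⟩` for `𝒲` equals `⟨Y, ℬ Q⟩` for `W`,
up to a total derivative that integrates to zero. Hence `⟨𝒫_n, 𝒫_k⟩ = ⟨P_n, P_k⟩ (k - 1) D`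
(`form_excPoly`), and orthogonality and norms reduce to those of the scalar Hermite polynomials. The
weight `W` is indefinite because `1 - a² < 0`, but the signs of `n - 1`, of `D` and of the norm of
`P_n` compensate.

For density, the `P_n` of all degrees span the matrix polynomials, so the span of the `𝒫_n` is the
whole range of `𝒜` (the missing `𝒫_1` is zero). Since `𝒜(U S) = U' S F`, this range contains every
`R M` with `M = S F`. The determinant of `M` has no real zero and `M 𝒲 Mᵀ` is dominated by a
Gaussian, so approximating `f` by `R M` reduces to approximating the entries of `f M⁻¹`, after
truncation, by polynomials in a Gaussian `L²` space. There polynomials are dense: a function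
orthogonal to all of them has vanishing Fourier transform. -/

theorem matPoly_ext {P Q : MatPoly N} (h : ∀ t, evalAt P t = evalAt Q t) : P = Q := by
  ext1 i j
  refine Polynomial.funext fun t => ?_
  exact congrFun (congrFun (h t) i) j

theorem evalAt_eq_mapMatrix (P : MatPoly N) (t : ℝ) :
    evalAt P t = (Polynomial.evalRingHom t).mapMatrix P := rfl

@[simp] theorem evalAt_add (P Q : MatPoly N) (t : ℝ) :
    evalAt (P + Q) t = evalAt P t + evalAt Q t := by
  simp only [evalAt_eq_mapMatrix, map_add]

@[simp] theorem evalAt_sub (P Q : MatPoly N) (t : ℝ) :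
    evalAt (P - Q) t = evalAt P t - evalAt Q t := by
  simp only [evalAt_eq_mapMatrix, map_sub]

@[simp] theorem evalAt_neg (P : MatPoly N) (t : ℝ) :
    evalAt (-P) t = -evalAt P t := by
  simp only [evalAt_eq_mapMatrix, map_neg]

@[simp] theorem evalAt_mul (P Q : MatPoly N) (t : ℝ) :
    evalAt (P * Q) t = evalAt P t * evalAt Q t := by
  simp only [evalAt_eq_mapMatrix, map_mul]

@[simp] theorem evalAt_one (t : ℝ) : evalAt (1 : MatPoly N) t = 1 := by
  simp only [evalAt_eq_mapMatrix, map_one]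

@[simp] theorem evalAt_smul (q : ℝ[X]) (P : MatPoly N) (t : ℝ) :
    evalAt (q • P) t = q.eval t • evalAt P t := by
  ext i j; simp [evalAt]

@[simp] theorem evalAt_const (A : Matrix (Fin N) (Fin N) ℝ) (t : ℝ) :
    evalAt (const A) t = A := by
  ext i j; simp [evalAt, const]

theorem evalAt_apply (P : MatPoly N) (t : ℝ) (i j : Fin N) :
    evalAt P t i j = (P i j).eval t := rfl

theorem der_apply (P : MatPoly N) (i j : Fin N) :
    der P i j = Polynomial.derivative (P i j) := rfl

@[simp] theorem der_add (P Q : MatPoly N) : der (P + Q) = der P + der Q := by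
  ext1 i j; simp [der_apply]

@[simp] theorem der_sub (P Q : MatPoly N) : der (P - Q) = der P - der Q := by
  ext1 i j; simp [der_apply]

@[simp] theorem der_zero : der (0 : MatPoly N) = 0 := by
  ext1 i j; simp [der_apply]

@[simp] theorem der_const (A : Matrix (Fin N) (Fin N) ℝ) : der (const A) = 0 := by
  ext1 i j; simp [der_apply, const]

theorem der_mul (P Q : MatPoly N) : der (P * Q) = der P * Q + P * der Q := by
  ext1 i j
  simp [der_apply, Matrix.mul_apply, Finset.sum_add_distrib]

theorem der_smul (q : ℝ[X]) (P : MatPoly N) :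
    der (q • P) = Polynomial.derivative q • P + q • der P := by
  ext1 i j; simp [der_apply]

/-! ### Hermite polynomials -/

theorem derivative_H (n : ℕ) : Polynomial.derivative (H n) = 2 * (n : ℝ[X]) * H (n - 1) := by
  induction n with
  | zero => simp [H]
  | succ n ih =>
    rw [H, Polynomial.derivative_sub, ih]
    cases n with
    | zero => simp [H]
    | succ m =>
      simp only [Nat.add_sub_cancel] at ih ⊢
      simp only [Polynomial.derivative_mul, Polynomial.derivative_ofNat, Polynomial.derivative_X,
        ih, Polynomial.derivative_natCast]
      rw [H]
      push_cast
      ring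

theorem H_two_X_mul (n : ℕ) : 2 * Polynomial.X * H n = H (n + 1) + 2 * (n : ℝ[X]) * H (n - 1) := by
  rw [H, derivative_H]; ring

theorem natDegree_H_le (n : ℕ) : (H n).natDegree ≤ n ∧ (H n).coeff n = 2 ^ n := by
  induction n with
  | zero => simp [H]
  | succ n ih =>
    have h1 : (Polynomial.derivative (H n)).natDegree ≤ n :=
      (Polynomial.natDegree_derivative_le _).trans (by omega)
    have h2 : (2 * Polynomial.X * H n : ℝ[X]) = Polynomial.C 2 * (Polynomial.X * H n) := by
      rw [map_ofNat]; ring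
    have h3 : (Polynomial.X * H n : ℝ[X]).natDegree ≤ n + 1 :=
      Polynomial.natDegree_mul_le.trans (by simp; omega)
    refine ⟨?_, ?_⟩
    · rw [H, h2]
      exact (Polynomial.natDegree_sub_le _ _).trans
        (max_le ((Polynomial.natDegree_C_mul_le _ _).trans h3) (by omega))
    · rw [H, h2, Polynomial.coeff_sub, Polynomial.coeff_C_mul, Polynomial.coeff_X_mul, ih.2,
        Polynomial.coeff_eq_zero_of_natDegree_lt (show _ < n + 1 by omega)]
      ring

/-! ### The quasi-Darboux transformation -/

/-- The matrix polynomial `(P₁')⁻¹ P₁`. -/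
def darbouxFactor (a : ℝ) : MatPoly 2 :=
  !![Polynomial.X, Polynomial.C (-(a / 2)); Polynomial.C (a / (a ^ 2 - 2)), Polynomial.X]

theorem evalAt_darbouxFactor (a t : ℝ) :
    evalAt (darbouxFactor a) t = !![t, -(a / 2); a / (a ^ 2 - 2), t] := by
  ext i j; fin_cases i <;> fin_cases j <;> simp [evalAt, darbouxFactor]

theorem der_darbouxFactor (a : ℝ) : der (darbouxFactor a) = 1 := by
  ext1 i j; fin_cases i <;> fin_cases j <;> simp [der_apply, darbouxFactor]

theorem evalAt_seed (a t : ℝ) : evalAt (seed a) t = !![2 * t, -a; -a, (2 - a ^ 2) * t] := by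
  rw [seed_eq]
  ext i j; fin_cases i <;> fin_cases j <;> simp [evalAt]

theorem der_seed (a : ℝ) : der (seed a) = const !![2, 0; 0, 2 - a ^ 2] := by
  rw [seed_eq]
  ext1 i j; fin_cases i <;> fin_cases j <;> simp [der_apply, const, map_ofNat Polynomial.C]

theorem der_seed_inv_mul_seed {a : ℝ} (ha : 2 < a ^ 2) :
    (der (seed a))⁻¹ * seed a = darbouxFactor a := by
  have hc : a ^ 2 - 2 ≠ 0 := by linarith
  have h : seed a = der (seed a) * darbouxFactor a := by
    refine matPoly_ext fun t => ?_
    rw [der_seed, evalAt_mul, evalAt_const, evalAt_seed, evalAt_darbouxFactor]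
    ext i j; fin_cases i <;> fin_cases j <;> simp [Matrix.mul_apply, Fin.sum_univ_two]
    · ring
    · field_simp; ring
  calc (der (seed a))⁻¹ * seed a = (der (seed a))⁻¹ * (der (seed a) * darbouxFactor a) :=
        congrArg _ h
    _ = darbouxFactor a := by
        rw [← Matrix.mul_assoc, Matrix.nonsing_inv_mul _ (isUnit_det_der_seed a ha), Matrix.one_mul]

theorem der_seed_mul_darbouxFactor {a : ℝ} (ha : 2 < a ^ 2) :
    der (seed a) * darbouxFactor a = seed a := by
  rw [← der_seed_inv_mul_seed ha, ← Matrix.mul_assoc,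
    Matrix.mul_nonsing_inv _ (isUnit_det_der_seed a ha), Matrix.one_mul]

theorem quasiDarboux_seed {a : ℝ} (ha : 2 < a ^ 2) (Y : MatPoly 2) :
    quasiDarboux (seed a) Y = der Y * darbouxFactor a - Y := by
  rw [quasiDarboux, Matrix.mul_assoc, der_seed_inv_mul_seed ha]; abel

theorem excPoly_eq {a : ℝ} (ha : 2 < a ^ 2) (n : ℕ) :
    excPoly a n = der (hermitePoly a (1 - a ^ 2) n) * darbouxFactor a
      - hermitePoly a (1 - a ^ 2) n := quasiDarboux_seed ha _

theorem excPoly_one {a : ℝ} (ha : 2 < a ^ 2) : excPoly a 1 = 0 := by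
  rw [excPoly_eq ha, ← seed, der_seed_mul_darbouxFactor ha, sub_self]

/-- Because `F' = 1`, the first order terms of the derivative cancel; this is what lets the partner
operator act on `𝒫_n` through the second derivative of `P_n` alone. -/
theorem der_excPoly {a : ℝ} (ha : 2 < a ^ 2) (n : ℕ) :
    der (excPoly a n) = der (der (hermitePoly a (1 - a ^ 2) n)) * darbouxFactor a := by
  rw [excPoly_eq ha, der_sub, der_mul, der_darbouxFactor, Matrix.mul_one, add_sub_cancel_right]

/-- The eigenvalue matrix `diag (1 / (2 (a² - 2)), -1 / (a² - 2)²)`. -/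
def eigenDiag (a : ℝ) : Matrix (Fin 2) (Fin 2) ℝ :=
  !![1 / (2 * (a ^ 2 - 2)), 0; 0, -(1 / (a ^ 2 - 2) ^ 2)]

/-- The numerator of the first order coefficient of the adjoint operator
`Q ↦ Q D - Q' K / 𝔭`, with `D = eigenDiag a`. -/
def adjCoeff (a : ℝ) : MatPoly 2 :=
  !![Polynomial.C (1 / (a ^ 2 - 2)) * Polynomial.X,
      -Polynomial.C (a / (4 * (a ^ 2 - 2))) *
        (Polynomial.C (2 * a ^ 2) * Polynomial.X ^ 2 + Polynomial.C (a ^ 2 - 2));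
    -Polynomial.C (a / (a ^ 2 - 2) ^ 2),
      Polynomial.C (2 * (a ^ 2 - 1) / (a ^ 2 - 2) ^ 2) * Polynomial.X]

theorem evalAt_adjCoeff (a t : ℝ) :
    evalAt (adjCoeff a) t =
      !![1 / (a ^ 2 - 2) * t, -(a / (4 * (a ^ 2 - 2))) * (2 * a ^ 2 * t ^ 2 + (a ^ 2 - 2));
        -(a / (a ^ 2 - 2) ^ 2), 2 * (a ^ 2 - 1) / (a ^ 2 - 2) ^ 2 * t] := by
  ext i j; fin_cases i <;> fin_cases j <;>
    simp [evalAt, adjCoeff, -map_mul, -map_sub, -map_pow]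

/-- The quotient of `darbouxFactor a * adjCoeff a` by `𝔭`. -/
def secondCoeff (a : ℝ) : MatPoly 2 :=
  !![-Polynomial.C (1 / (2 * (a ^ 2 - 2) ^ 2)),
      Polynomial.C (a ^ 3 / (4 * (a ^ 2 - 2) ^ 2)) * Polynomial.X;
    0, Polynomial.C (1 / (4 * (a ^ 2 - 2)))]

theorem evalAt_secondCoeff (a t : ℝ) :
    evalAt (secondCoeff a) t =
      !![-(1 / (2 * (a ^ 2 - 2) ^ 2)), a ^ 3 / (4 * (a ^ 2 - 2) ^ 2) * t;
        0, 1 / (4 * (a ^ 2 - 2))] := by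
  ext i j; fin_cases i <;> fin_cases j <;>
    simp [evalAt, secondCoeff, -map_mul, -map_sub, -map_pow]

/-- This divisibility removes the denominator `𝔭` when the partner operator is composed with `𝒜`. -/
theorem darbouxFactor_mul_adjCoeff {a : ℝ} (ha : 2 < a ^ 2) :
    darbouxFactor a * adjCoeff a = pfrak a • secondCoeff a := by
  have hc : a ^ 2 - 2 ≠ 0 := by linarith
  refine matPoly_ext fun t => ?_
  rw [evalAt_mul, evalAt_smul, evalAt_darbouxFactor, evalAt_adjCoeff, evalAt_secondCoeff,
    pfrak_eval]
  ext i j; fin_cases i <;> fin_cases j <;> simp [Matrix.mul_apply, Fin.sum_univ_two]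
  all_goals field_simp
  all_goals ring

theorem evalAt_hermitePoly (a ξ : ℝ) (n : ℕ) (t : ℝ) :
    evalAt (hermitePoly a ξ n) t =
      !![(H n).eval t, -(a * (n * (H (n - 1)).eval t));
        -(a * (n * (H (n - 1)).eval t)),
        ξ * (H n).eval t + a ^ 2 * t * (n * (H (n - 1)).eval t)] := by
  ext i j; fin_cases i <;> fin_cases j <;> simp [evalAt, hermitePoly, const] <;> ring

/-- The polynomial `n H_{n-1} = H_n' / 2`. -/
def G (n : ℕ) : ℝ[X] := (n : ℝ[X]) * H (n - 1)

theorem derivative_H_eq_G (n : ℕ) : Polynomial.derivative (H n) = 2 * G n := by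
  rw [derivative_H, G]; ring

/-- Hermite's equation in first order form: the span of `H n` and `G n` over the polynomials is
closed under differentiation, so identities in `P_n` and its derivatives reduce to algebra in two
unknowns. -/
theorem derivative_G (n : ℕ) :
    Polynomial.derivative (G n) = 2 * Polynomial.X * G n - (n : ℝ[X]) * H n := by
  cases n with
  | zero => simp [G]
  | succ m =>
    simp only [G, Nat.add_sub_cancel, Polynomial.derivative_mul, Polynomial.derivative_natCast, H]
    ring

theorem hermitePoly_eq (a ξ : ℝ) (n : ℕ) :
    hermitePoly a ξ n =
      !![H n, -(Polynomial.C a * G n);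
        -(Polynomial.C a * G n),
        Polynomial.C ξ * H n + Polynomial.C (a ^ 2) * Polynomial.X * G n] := by
  refine matPoly_ext fun t => ?_
  rw [evalAt_hermitePoly]
  ext i j; fin_cases i <;> fin_cases j <;> simp [evalAt, G]

/-- The partner operator applied to `𝒜(P_n)`: the `P_n` are eigenfunctions of the composition, with
the matrix eigenvalue `(n - 1) D` acting on the left. -/
theorem hermitePoly_ode {a : ℝ} (ha : 2 < a ^ 2) (n : ℕ) :
    excPoly a n * const (eigenDiag a)
        - der (der (hermitePoly a (1 - a ^ 2) n)) * secondCoeff a =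
      const (((n : ℝ) - 1) • eigenDiag a) * hermitePoly a (1 - a ^ 2) n := by
  have hc : a ^ 2 - 2 ≠ 0 := by linarith
  rw [excPoly_eq ha]
  refine matPoly_ext fun t => ?_
  simp only [evalAt_mul, evalAt_sub, evalAt_const, evalAt_secondCoeff, evalAt_darbouxFactor]
  ext i j; fin_cases i <;> fin_cases j <;>
    simp [hermitePoly_eq, evalAt, der, Matrix.mul_apply, Fin.sum_univ_two,
      eigenDiag, derivative_H_eq_G, derivative_G, -map_pow]
  all_goals field_simp
  all_goals ring

theorem adjoint_excPoly {a : ℝ} (ha : 2 < a ^ 2) (n : ℕ) :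
    pfrak a • (excPoly a n * const (eigenDiag a)) - der (excPoly a n) * adjCoeff a =
      pfrak a • (const (((n : ℝ) - 1) • eigenDiag a) * hermitePoly a (1 - a ^ 2) n) := by
  rw [← hermitePoly_ode ha, der_excPoly ha, Matrix.mul_assoc, darbouxFactor_mul_adjCoeff ha,
    smul_sub, Matrix.mul_smul]

/-! ### Degrees -/

theorem natDegree_G_le (n : ℕ) : (G n).natDegree ≤ n - 1 := by
  rw [G, ← Polynomial.C_eq_natCast]
  exact (Polynomial.natDegree_C_mul_le _ _).trans (natDegree_H_le _).1

theorem coeff_G_self (n : ℕ) : (G n).coeff n = 0 := by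
  cases n with
  | zero => simp [G]
  | succ m =>
    exact Polynomial.coeff_eq_zero_of_natDegree_lt ((natDegree_G_le _).trans_lt (by simp))

theorem natDegree_X_mul_G_le (n : ℕ) : (Polynomial.X * G n).natDegree ≤ n := by
  cases n with
  | zero => simp [G]
  | succ m =>
    have := natDegree_G_le (m + 1)
    exact Polynomial.natDegree_mul_le.trans (by simp at this ⊢; omega)

theorem coeff_X_mul_G (n : ℕ) : (Polynomial.X * G n).coeff n = (n : ℝ) * 2 ^ n / 2 := by
  cases n with
  | zero => simp [G]
  | succ m =>
    rw [Polynomial.coeff_X_mul, G, ← Polynomial.C_eq_natCast, Polynomial.coeff_C_mul,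
      Nat.add_sub_cancel, (natDegree_H_le m).2]
    push_cast; ring

/-- Polynomials of degree at most `n` with coefficient `c` at `X ^ n`. -/
def HasTop (n : ℕ) (q : ℝ[X]) (c : ℝ) : Prop := q.natDegree ≤ n ∧ q.coeff n = c

theorem HasTop.add {n : ℕ} {q r : ℝ[X]} {c d : ℝ} (hq : HasTop n q c) (hr : HasTop n r d) :
    HasTop n (q + r) (c + d) :=
  ⟨(Polynomial.natDegree_add_le _ _).trans (max_le hq.1 hr.1), by
    rw [Polynomial.coeff_add, hq.2, hr.2]⟩

theorem HasTop.C_mul {n : ℕ} {q : ℝ[X]} {c : ℝ} (hq : HasTop n q c) (x : ℝ) :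
    HasTop n (Polynomial.C x * q) (x * c) :=
  ⟨(Polynomial.natDegree_C_mul_le _ _).trans hq.1, by rw [Polynomial.coeff_C_mul, hq.2]⟩

theorem hasTop_H (n : ℕ) : HasTop n (H n) (2 ^ n) := natDegree_H_le n

theorem hasTop_G (n : ℕ) : HasTop n (G n) 0 :=
  ⟨(natDegree_G_le n).trans (Nat.sub_le _ _), coeff_G_self n⟩

theorem hasTop_X_mul_G (n : ℕ) : HasTop n (Polynomial.X * G n) ((n : ℝ) * 2 ^ n / 2) :=
  ⟨natDegree_X_mul_G_le n, coeff_X_mul_G n⟩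

theorem HasTop.X_mul_derivative {n : ℕ} {q : ℝ[X]} {c : ℝ} (hq : HasTop n q c) :
    HasTop n (Polynomial.X * Polynomial.derivative q) (n * c) := by
  have h := Polynomial.natDegree_derivative_le q
  have h1 := hq.1
  cases n with
  | zero =>
    rw [Nat.le_zero, Polynomial.natDegree_eq_zero] at h1
    obtain ⟨x, rfl⟩ := h1
    simp [HasTop]
  | succ m =>
    refine ⟨Polynomial.natDegree_mul_le.trans (by simp; omega), ?_⟩
    rw [Polynomial.coeff_X_mul, Polynomial.coeff_derivative, hq.2]
    push_cast; ring

theorem HasTop.derivative {n : ℕ} {q : ℝ[X]} {c : ℝ} (hq : HasTop n q c) :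
    HasTop n (Polynomial.derivative q) 0 := by
  have h := Polynomial.natDegree_derivative_le q
  have h1 := hq.1
  refine ⟨by omega, ?_⟩
  rw [Polynomial.coeff_derivative, Polynomial.coeff_eq_zero_of_natDegree_lt (by omega), zero_mul]

theorem hasDegreeNonsingular_of_hasTop {P : MatPoly 2} {n : ℕ} {x y : ℝ}
    (h00 : HasTop n (P 0 0) x) (h01 : HasTop n (P 0 1) 0) (h10 : HasTop n (P 1 0) 0)
    (h11 : HasTop n (P 1 1) y) (hx : x ≠ 0) (hy : y ≠ 0) : HasDegreeNonsingular P n := by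
  refine ⟨fun i j => ?_, ?_⟩
  · fin_cases i <;> fin_cases j
    exacts [h00.1, h01.1, h10.1, h11.1]
  · rw [Matrix.det_fin_two]
    simp only [Matrix.map_apply, h00.2, h01.2, h10.2, h11.2]
    simpa using ⟨hx, hy⟩

theorem hasTop_hermitePoly (a ξ : ℝ) (n : ℕ) :
    HasTop n (hermitePoly a ξ n 0 0) (2 ^ n) ∧ HasTop n (hermitePoly a ξ n 0 1) 0 ∧
    HasTop n (hermitePoly a ξ n 1 0) 0 ∧
    HasTop n (hermitePoly a ξ n 1 1) (2 ^ n * (ξ + a ^ 2 * n / 2)) := by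
  rw [hermitePoly_eq]
  have h1 : HasTop n (-(Polynomial.C a * G n)) 0 := by
    simpa using (hasTop_G n).C_mul (-a)
  refine ⟨hasTop_H n, h1, h1, ?_⟩
  have h2 := ((hasTop_H n).C_mul ξ).add ((hasTop_X_mul_G n).C_mul (a ^ 2))
  simp only [Matrix.of_apply, Matrix.cons_val_one, Matrix.cons_val_fin_one]
  rw [mul_assoc]
  convert h2 using 1
  ring

theorem leading_ne_zero {a : ℝ} (ha : 2 < a ^ 2) (n : ℕ) :
    (1 - a ^ 2) + a ^ 2 * n / 2 ≠ 0 := by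
  rcases n with _ | _ | n
  · simp; linarith
  · simp; intro h; linarith
  · push_cast
    have : 0 ≤ a ^ 2 * n := by positivity
    intro h; nlinarith

theorem hermitePoly_degree {a : ℝ} (ha : 2 < a ^ 2) (n : ℕ) :
    HasDegreeNonsingular (hermitePoly a (1 - a ^ 2) n) n := by
  obtain ⟨h00, h01, h10, h11⟩ := hasTop_hermitePoly a (1 - a ^ 2) n
  exact hasDegreeNonsingular_of_hasTop h00 h01 h10 h11 (by positivity)
    (mul_ne_zero (by positivity) (leading_ne_zero ha n))

/-- `F` is `X` times the identity plus a constant matrix, so in degree `n` the operator `𝒜` acts as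
`X d/dX - 1`: it multiplies the leading coefficient of `P_n` by `n - 1`, which vanishes exactly at
the gap. -/
theorem excPoly_degree {a : ℝ} (ha : 2 < a ^ 2) {n : ℕ} (hn : n ≠ 1) :
    HasDegreeNonsingular (excPoly a n) n := by
  obtain ⟨h00, h01, h10, h11⟩ := hasTop_hermitePoly a (1 - a ^ 2) n
  have hn' : (n : ℝ) - 1 ≠ 0 := sub_ne_zero.mpr (by exact_mod_cast hn)
  refine hasDegreeNonsingular_of_hasTop (x := (n - 1) * 2 ^ n)
    (y := (n - 1) * (2 ^ n * ((1 - a ^ 2) + a ^ 2 * n / 2))) ?_ ?_ ?_ ?_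
    (mul_ne_zero hn' (by positivity))
    (mul_ne_zero hn' (mul_ne_zero (by positivity) (leading_ne_zero ha n)))
  all_goals
    rw [excPoly_eq ha]
    simp only [Matrix.sub_apply, Matrix.mul_apply, Fin.sum_univ_two, der_apply, darbouxFactor,
      Matrix.of_apply, Matrix.cons_val_zero, Matrix.cons_val_one, Matrix.cons_val_fin_one]
  · convert ((h00.X_mul_derivative.add (h01.derivative.C_mul (a / (a ^ 2 - 2)))).add
      (h00.C_mul (-1))) using 1
    · simp; ring
    · ring
  · convert ((h01.X_mul_derivative.add (h00.derivative.C_mul (-(a / 2)))).add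
      (h01.C_mul (-1))) using 1
    · simp; ring
    · ring
  · convert ((h10.X_mul_derivative.add (h11.derivative.C_mul (a / (a ^ 2 - 2)))).add
      (h10.C_mul (-1))) using 1
    · simp; ring
    · ring
  · convert ((h11.X_mul_derivative.add (h10.derivative.C_mul (-(a / 2)))).add
      (h11.C_mul (-1))) using 1
    · simp; ring
    · ring

/-! ### The differential operator -/

theorem toRat_mul (P Q : MatPoly N) : toRat (P * Q) = toRat P * toRat Q :=
  map_mul (algebraMap ℝ[X] (RatFunc ℝ)).mapMatrix P Q

theorem toRat_add (P Q : MatPoly N) : toRat (P + Q) = toRat P + toRat Q :=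
  map_add (algebraMap ℝ[X] (RatFunc ℝ)).mapMatrix P Q

theorem toRat_smul (q : ℝ[X]) (P : MatPoly N) :
    toRat (q • P) = algebraMap ℝ[X] (RatFunc ℝ) q • toRat P := by
  ext i j; simp [toRat]

theorem toRat_injective : Function.Injective (toRat (N := N)) := fun P Q h => by
  ext1 i j
  exact RatFunc.algebraMap_injective ℝ (congrFun (congrFun h i) j)

/-- A polynomial identity between `q • (const Γ * Y)` and a differential expression in `Y`, divided
by `q`. -/
theorem diffOp_of_polynomial {q : ℝ[X]} (hq : q ≠ 0) (f₂ f₁ f₀ Y : MatPoly N)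
    (Γ : Matrix (Fin N) (Fin N) ℝ)
    (h : der (der Y) * f₂ + der Y * f₁ + Y * f₀ = q • (const Γ * Y)) :
    diffOp ((algebraMap ℝ[X] (RatFunc ℝ) q)⁻¹ • toRat f₂)
      ((algebraMap ℝ[X] (RatFunc ℝ) q)⁻¹ • toRat f₁)
      ((algebraMap ℝ[X] (RatFunc ℝ) q)⁻¹ • toRat f₀) Y = toRat (const Γ) * toRat Y := by
  have hq' : algebraMap ℝ[X] (RatFunc ℝ) q ≠ 0 := by simpa using hq
  rw [diffOp, Matrix.mul_smul, Matrix.mul_smul, Matrix.mul_smul, ← smul_add, ← smul_add,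
    ← toRat_mul, ← toRat_mul, ← toRat_mul, ← toRat_add, ← toRat_add, h, toRat_smul, toRat_mul,
    inv_smul_smul₀ hq']

/-- `-𝔭(t) = 2 (a² - 2) t² + a²` is at least `a² > 2`. The bound also gives `|𝔭| ≥ 1`, so that
powers of `𝔭` in a denominator never hurt integrability. -/
theorem pfrak_eval_le {a : ℝ} (ha : 2 < a ^ 2) (t : ℝ) : (pfrak a).eval t ≤ -2 := by
  rw [pfrak_eval]; nlinarith [mul_nonneg (sub_nonneg.2 ha.le) (sq_nonneg t)]

theorem pfrak_eval_ne_zero {a : ℝ} (ha : 2 < a ^ 2) (t : ℝ) : (pfrak a).eval t ≠ 0 := by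
  linarith [pfrak_eval_le ha t]

theorem pfrak_ne_zero {a : ℝ} (ha : 2 < a ^ 2) : pfrak a ≠ 0 := fun h =>
  pfrak_eval_ne_zero ha 0 (by rw [h, Polynomial.eval_zero])

/-- The identity `𝒜(ℬ(𝒫_n)) = (n - 1) D 𝒫_n` multiplied by `𝔭²`, with the composition `𝒜 ∘ ℬ`
expanded. -/
theorem excPoly_polynomial_ode {a : ℝ} (ha : 2 < a ^ 2) (n : ℕ) :
    der (der (excPoly a n)) * (-(pfrak a • (adjCoeff a * darbouxFactor a)))
      + der (excPoly a n) * (pfrak a ^ 2 • (const (eigenDiag a) * darbouxFactor a)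
        + Polynomial.derivative (pfrak a) • (adjCoeff a * darbouxFactor a)
        - pfrak a • (der (adjCoeff a) * darbouxFactor a) + pfrak a • adjCoeff a)
      + excPoly a n * (-(pfrak a ^ 2 • const (eigenDiag a))) =
    pfrak a ^ 2 • (const (((n : ℝ) - 1) • eigenDiag a) * excPoly a n) := by
  have h0 := adjoint_excPoly ha n
  have h1 := congrArg der h0
  rw [der_sub, der_smul, der_smul, der_mul, der_mul, der_mul, der_const, der_const] at h1
  rw [Matrix.mul_zero, add_zero, Matrix.zero_mul, zero_add] at h1
  have h2 : excPoly a n = der (hermitePoly a (1 - a ^ 2) n) * darbouxFactor a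
    - hermitePoly a (1 - a ^ 2) n := excPoly_eq ha n
  generalize hermitePoly a (1 - a ^ 2) n = y at *
  generalize const (((n : ℝ) - 1) • eigenDiag a) = Γ at *
  generalize Polynomial.derivative (pfrak a) = p' at *
  generalize pfrak a = p at *
  have h3 : p ^ 2 • (Γ * der y) =
      p • (p' • (excPoly a n * const (eigenDiag a)) + p • (der (excPoly a n) * const (eigenDiag a))
        - (der (der (excPoly a n)) * adjCoeff a + der (excPoly a n) * der (adjCoeff a)))
      - p' • (p • (excPoly a n * const (eigenDiag a)) - der (excPoly a n) * adjCoeff a) := by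
    rw [h1, h0]
    module
  have h4 : p ^ 2 • (Γ * excPoly a n) = p ^ 2 • (Γ * der y) * darbouxFactor a
      - p • p • (Γ * y) := by
    conv_lhs => rw [h2]
    rw [Matrix.mul_sub, smul_sub, Matrix.smul_mul, Matrix.mul_assoc, smul_smul, sq]
  rw [h4, h3, ← h0]
  simp only [Matrix.mul_add, Matrix.mul_sub, Matrix.sub_mul, Matrix.add_mul, Matrix.smul_mul,
    Matrix.mul_smul, Matrix.mul_neg, Matrix.mul_assoc]
  module

theorem exists_eigen_operator {a : ℝ} (ha : 2 < a ^ 2) :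
    ∃ F₂ F₁ F₀ : Matrix (Fin 2) (Fin 2) (RatFunc ℝ), F₂ ≠ 0 ∧
      ∀ n : ℕ, ∃ Γ : Matrix (Fin 2) (Fin 2) ℝ,
        diffOp F₂ F₁ F₀ (excPoly a n) = toRat (const Γ) * toRat (excPoly a n) := by
  have hc : a ^ 2 - 2 ≠ 0 := by linarith
  have hp : pfrak a ^ 2 ≠ 0 := pow_ne_zero 2 (pfrak_ne_zero ha)
  refine ⟨_, _, _, ?_, fun n => ⟨_, diffOp_of_polynomial hp _ _ _ _ _
    (excPoly_polynomial_ode ha n)⟩⟩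
  intro h
  rw [smul_eq_zero, inv_eq_zero] at h
  rcases h with h | h
  · exact hp (by simpa using h)
  · have h0 : toRat (0 : MatPoly 2) = 0 := map_zero (algebraMap ℝ[X] (RatFunc ℝ)).mapMatrix
    -- At the origin the `(0, 0)` entry of `K F` is `-a² / (4 (a² - 2))`, which is not zero.
    have h1 := congrArg (fun M => evalAt M 0 0 0) (toRat_injective (h.trans h0.symm))
    simp only [evalAt_neg, evalAt_smul, evalAt_mul, evalAt_adjCoeff, evalAt_darbouxFactor] at h1
    have h2 := pfrak_eval_ne_zero ha 0
    have ha0 : a ≠ 0 := by rintro rfl; norm_num at ha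
    simp [evalAt, h2, ha0, hc] at h1

open MeasureTheory

/-! ### Polynomials against the Gaussian -/

/-- Half of the Gaussian exponent is given up to absorb the polynomial. -/
theorem exists_abs_eval_le_exp (q : ℝ[X]) :
    ∃ C : ℝ, 0 ≤ C ∧ ∀ t : ℝ, |q.eval t| ≤ C * Real.exp (t ^ 2 / 2) := by
  induction q using Polynomial.induction_on' with
  | add p q hp hq =>
    obtain ⟨C, hC0, hC⟩ := hp
    obtain ⟨D, hD0, hD⟩ := hq
    refine ⟨C + D, by positivity, fun t => ?_⟩
    rw [Polynomial.eval_add, add_mul]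
    exact (abs_add_le _ _).trans (add_le_add (hC t) (hD t))
  | monomial n c =>
    refine ⟨|c| * (1 + n.factorial * 2 ^ n), by positivity, fun t => ?_⟩
    have h1 : |t| ^ n ≤ 1 + (t ^ 2) ^ n := by
      have h : (t ^ 2) ^ n = (|t| ^ n) ^ 2 := by rw [← sq_abs t]; ring
      rw [h]; nlinarith [sq_nonneg (|t| ^ n - 1), sq_nonneg (|t| ^ n)]
    have h2 : (t ^ 2) ^ n ≤ n.factorial * 2 ^ n * Real.exp (t ^ 2 / 2) := by
      have h := Real.pow_div_factorial_le_exp (t ^ 2 / 2) (by positivity) n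
      rw [div_le_iff₀ (by positivity), div_pow, div_le_iff₀ (by positivity)] at h
      linarith
    have h3 : 1 ≤ Real.exp (t ^ 2 / 2) := Real.one_le_exp (by positivity)
    rw [Polynomial.eval_monomial, abs_mul, abs_pow, mul_assoc]
    refine mul_le_mul_of_nonneg_left ?_ (abs_nonneg c)
    linarith

theorem exists_abs_eval_mul_exp_le (q : ℝ[X]) :
    ∃ C : ℝ, 0 ≤ C ∧ ∀ t : ℝ, |q.eval t * Real.exp (-t ^ 2)| ≤ C * Real.exp (-t ^ 2 / 2) := by
  obtain ⟨C, hC0, hC⟩ := exists_abs_eval_le_exp q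
  refine ⟨C, hC0, fun t => ?_⟩
  have h : Real.exp (-t ^ 2 / 2) = Real.exp (t ^ 2 / 2) * Real.exp (-t ^ 2) := by
    rw [← Real.exp_add]; ring_nf
  rw [abs_mul, Real.abs_exp, h, ← mul_assoc]
  exact mul_le_mul_of_nonneg_right (hC t) (Real.exp_pos _).le

theorem integrable_exp_neg_sq_half : Integrable fun t : ℝ => Real.exp (-t ^ 2 / 2) := by
  convert integrable_exp_neg_mul_sq (b := 1 / 2) (by norm_num) using 2
  ring_nf

theorem integrable_eval_mul_exp (q : ℝ[X]) :
    Integrable fun t : ℝ => q.eval t * Real.exp (-t ^ 2) := by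
  obtain ⟨C, -, hC⟩ := exists_abs_eval_mul_exp_le q
  refine (integrable_exp_neg_sq_half.const_mul C).mono'
    (Continuous.aestronglyMeasurable (by fun_prop)) (Filter.Eventually.of_forall hC)

theorem abs_div_pfrak_pow_le {a : ℝ} (ha : 2 < a ^ 2) (k : ℕ) (x t : ℝ) :
    |x / (pfrak a).eval t ^ k| ≤ |x| := by
  rw [abs_div]
  refine div_le_self (abs_nonneg x) ?_
  rw [abs_pow]
  refine one_le_pow₀ ?_
  rw [abs_of_nonpos (by linarith [pfrak_eval_le ha t])]
  linarith [pfrak_eval_le ha t]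

theorem integrable_eval_mul_exp_div {a : ℝ} (ha : 2 < a ^ 2) (q : ℝ[X]) (k : ℕ) :
    Integrable fun t : ℝ => q.eval t * Real.exp (-t ^ 2) / (pfrak a).eval t ^ k := by
  refine (integrable_eval_mul_exp q).mono (Continuous.aestronglyMeasurable ?_)
    (Filter.Eventually.of_forall fun t => abs_div_pfrak_pow_le ha k _ t)
  exact Continuous.div (by fun_prop) (by fun_prop) fun t => pow_ne_zero k (pfrak_eval_ne_zero ha t)

theorem hasDerivAt_exp_neg_sq (t : ℝ) :
    HasDerivAt (fun s : ℝ => Real.exp (-s ^ 2)) (Real.exp (-t ^ 2) * (-(2 * t))) t := by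
  simpa using ((hasDerivAt_pow 2 t).neg).exp

/-- The integrand is the derivative of `q e^{-t²} / 𝔭`, brought to the denominator `𝔭²`. -/
theorem integral_derivative_mul_exp_div {a : ℝ} (ha : 2 < a ^ 2) (q : ℝ[X]) :
    ∫ t : ℝ, (pfrak a * (Polynomial.derivative q - 2 * Polynomial.X * q)
      - Polynomial.derivative (pfrak a) * q).eval t * Real.exp (-t ^ 2) / (pfrak a).eval t ^ 2
      = 0 := by
  refine integral_eq_zero_of_hasDerivAt_of_integrable
    (f := fun t => q.eval t * Real.exp (-t ^ 2) / (pfrak a).eval t ^ 1) (fun t => ?_)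
    (integrable_eval_mul_exp_div ha _ 2) (integrable_eval_mul_exp_div ha _ 1)
  have hp := pfrak_eval_ne_zero ha t
  have h := ((q.hasDerivAt t).mul (hasDerivAt_exp_neg_sq t)).div ((pfrak a).hasDerivAt t) hp
  simp only [pow_one]
  refine h.congr_deriv ?_
  simp
  ring

/-! ### Orthogonality of the Hermite polynomials -/

/-- Integration by parts, from `(H_n e^{-t²})' = -H_{n+1} e^{-t²}` and `H_m' = 2 m H_{m-1}`. For `m
= 0` the truncated index is harmless, its coefficient being zero. -/
theorem integral_H_mul_H_succ (m n : ℕ) :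
    ∫ t : ℝ, (H m * H (n + 1)).eval t * Real.exp (-t ^ 2) =
      2 * m * ∫ t : ℝ, (H (m - 1) * H n).eval t * Real.exp (-t ^ 2) := by
  have h : ∫ t : ℝ, ((Polynomial.C (2 * (m : ℝ)) * (H (m - 1) * H n)).eval t * Real.exp (-t ^ 2)
      - (H m * H (n + 1)).eval t * Real.exp (-t ^ 2)) = 0 := by
    refine integral_eq_zero_of_hasDerivAt_of_integrable
      (f := fun t => (H m * H n).eval t * Real.exp (-t ^ 2)) (fun t => ?_)
      ((integrable_eval_mul_exp _).sub (integrable_eval_mul_exp _)) (integrable_eval_mul_exp _)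
    refine (((H m * H n).hasDerivAt t).mul (hasDerivAt_exp_neg_sq t)).congr_deriv ?_
    rw [Polynomial.derivative_mul, derivative_H m, H]
    simp
    ring
  rw [integral_sub (integrable_eval_mul_exp _) (integrable_eval_mul_exp _), sub_eq_zero] at h
  rw [← h, ← integral_const_mul]
  congr 1 with t
  rw [Polynomial.eval_mul, Polynomial.eval_C, mul_assoc]

theorem integral_H_mul_H (m n : ℕ) :
    ∫ t : ℝ, (H m * H n).eval t * Real.exp (-t ^ 2) =
      if m = n then Real.sqrt Real.pi * 2 ^ n * n.factorial else 0 := by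
  induction n generalizing m with
  | zero =>
    cases m with
    | zero =>
      have h := integral_gaussian 1
      simp only [neg_mul, one_mul, div_one] at h
      simp [H, h]
    | succ m =>
      rw [mul_comm, integral_H_mul_H_succ]
      simp
  | succ n ih =>
    rw [integral_H_mul_H_succ, ih]
    cases m with
    | zero => simp
    | succ m =>
      simp only [Nat.add_sub_cancel, Nat.add_right_cancel_iff]
      split_ifs with h
      · subst h
        push_cast [Nat.factorial_succ]; ring
      · simp

theorem evalAt_transpose {N : ℕ} (P : MatPoly N) (t : ℝ) : evalAt Pᵀ t = (evalAt P t)ᵀ := rfl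

theorem evalAt_adjCoeff_transpose (a t : ℝ) :
    evalAt (adjCoeff a)ᵀ t =
      !![1 / (a ^ 2 - 2) * t, -(a / (a ^ 2 - 2) ^ 2);
        -(a / (4 * (a ^ 2 - 2))) * (2 * a ^ 2 * t ^ 2 + (a ^ 2 - 2)),
        2 * (a ^ 2 - 1) / (a ^ 2 - 2) ^ 2 * t] := by
  rw [evalAt_transpose, evalAt_adjCoeff]
  ext i j; fin_cases i <;> fin_cases j <;> rfl

/-! ### The weights as polynomial matrices times scalar functions -/

/-- The polynomial factor of the weight `W_{a,1-a²}`. -/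
def hermiteNum (a : ℝ) : MatPoly 2 :=
  !![Polynomial.C (1 - a ^ 2) + Polynomial.C (a ^ 2) * Polynomial.X ^ 2,
      Polynomial.C a * Polynomial.X;
    Polynomial.C a * Polynomial.X, 1]

theorem evalAt_hermiteNum (a t : ℝ) :
    evalAt (hermiteNum a) t = !![(1 - a ^ 2) + a ^ 2 * t ^ 2, a * t; a * t, 1] := by
  ext i j; fin_cases i <;> fin_cases j <;> simp [evalAt, hermiteNum, -map_sub, -map_pow]

theorem hermiteWeight_eq (a t : ℝ) :
    hermiteWeight a (1 - a ^ 2) t = Real.exp (-t ^ 2) • evalAt (hermiteNum a) t := by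
  rw [hermiteWeight, evalAt_hermiteNum]
  congr 1
  ext i j; fin_cases i <;> fin_cases j <;> simp [Matrix.mul_apply, Fin.sum_univ_two]
  ring

/-- The numerator of the weight `𝒲_a`. -/
def excNum (a : ℝ) : MatPoly 2 :=
  !![Polynomial.C (a ^ 2 / (4 * (a ^ 2 - 2))) * pfrak a ^ 2
        + Polynomial.C (1 / (a ^ 2 - 2)) * pfrak a - Polynomial.C (a ^ 2),
      Polynomial.C a * (Polynomial.C (1 / (a ^ 2 - 2)) * pfrak a - 2) * Polynomial.X;
    Polynomial.C a * (Polynomial.C (1 / (a ^ 2 - 2)) * pfrak a - 2) * Polynomial.X,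
      Polynomial.C (2 / (a ^ 2 - 2) ^ 2) * (Polynomial.C (a ^ 2 * (a ^ 2 - 2)) - pfrak a)]

theorem evalAt_excNum (a t : ℝ) :
    evalAt (excNum a) t =
      !![a ^ 2 / (4 * (a ^ 2 - 2)) * (pfrak a).eval t ^ 2 + (pfrak a).eval t / (a ^ 2 - 2) - a ^ 2,
        a * ((pfrak a).eval t / (a ^ 2 - 2) - 2) * t;
      a * ((pfrak a).eval t / (a ^ 2 - 2) - 2) * t,
        2 * (a ^ 2 * (a ^ 2 - 2) - (pfrak a).eval t) / (a ^ 2 - 2) ^ 2] := by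
  ext i j; fin_cases i <;> fin_cases j <;>
    simp [evalAt, excNum, -map_sub, -map_pow, -map_mul, div_eq_inv_mul]
  ring

theorem excWeight_eq (a t : ℝ) :
    excWeight a t =
      (Real.exp (-t ^ 2) / (pfrak a).eval t ^ 2) • evalAt (excNum a) t := by
  rw [evalAt_excNum]; rfl

theorem evalAt_mul_excWeight_mul_transpose (a : ℝ) (P Q : MatPoly 2) (t : ℝ) (i j : Fin 2) :
    (evalAt P t * excWeight a t * (evalAt Q t)ᵀ) i j =
      ((P * excNum a * Qᵀ) i j).eval t * Real.exp (-t ^ 2) / (pfrak a).eval t ^ 2 := by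
  rw [excWeight_eq, Matrix.mul_smul, Matrix.smul_mul, Matrix.smul_apply, ← evalAt_apply,
    evalAt_mul, evalAt_mul, smul_eq_mul, evalAt_transpose]
  ring

theorem form_excWeight_apply (a : ℝ) (P Q : MatPoly 2) (i j : Fin 2) :
    form (excWeight a) P Q i j = ∫ t : ℝ, ((P * excNum a * Qᵀ) i j).eval t * Real.exp (-t ^ 2)
      / (pfrak a).eval t ^ 2 := by
  simp only [form, Matrix.of_apply, evalAt_mul_excWeight_mul_transpose]

theorem form_hermiteWeight_apply (a : ℝ) (P Q : MatPoly 2) (i j : Fin 2) :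
    form (hermiteWeight a (1 - a ^ 2)) P Q i j =
      ∫ t : ℝ, ((P * hermiteNum a * Qᵀ) i j).eval t * Real.exp (-t ^ 2) := by
  simp only [form, Matrix.of_apply]
  congr 1 with t
  rw [hermiteWeight_eq, Matrix.mul_smul, Matrix.smul_mul, Matrix.smul_apply, ← evalAt_apply,
    evalAt_mul, evalAt_mul, smul_eq_mul, evalAt_transpose]
  ring

/-- The Gram matrices of the `P_n` with respect to `W_{a,1-a²}`. -/
theorem form_hermitePoly (a : ℝ) (n k : ℕ) :
    form (hermiteWeight a (1 - a ^ 2)) (hermitePoly a (1 - a ^ 2) n)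
        (hermitePoly a (1 - a ^ 2) k) =
      if n = k then (Real.sqrt Real.pi * 2 ^ n * (n.factorial : ℝ)) •
          !![(1 - a ^ 2) + a ^ 2 * ((n : ℝ) + 1) / 2, 0;
            0, (1 - a ^ 2) * ((1 - a ^ 2) + a ^ 2 * (n : ℝ) / 2)]
      else 0 := by
  have key : ∀ (c d : ℝ) (m₁ n₁ m₂ n₂ : ℕ),
      ∫ t : ℝ, (Polynomial.C c * (H m₁ * H n₁) + Polynomial.C d * (H m₂ * H n₂)).eval t
        * Real.exp (-t ^ 2) =
      c * (if m₁ = n₁ then Real.sqrt Real.pi * 2 ^ n₁ * n₁.factorial else 0) +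
      d * (if m₂ = n₂ then Real.sqrt Real.pi * 2 ^ n₂ * n₂.factorial else 0) := by
    intro c d m₁ n₁ m₂ n₂
    rw [← integral_H_mul_H, ← integral_H_mul_H, ← integral_const_mul, ← integral_const_mul,
      ← integral_add ((integrable_eval_mul_exp _).const_mul c)
        ((integrable_eval_mul_exp _).const_mul d)]
    congr 1 with t
    simp only [Polynomial.eval_add, Polynomial.eval_mul, Polynomial.eval_C]
    ring
  -- With `T = (1, at; 0, 1)`, the three term recurrence gives `P_n T = (H_n, a H_{n+1} / 2; -a n
  -- H_{n-1}, ξ H_n)`, and the product is `(P_n T) diag(ξ, 1) (P_k T)ᵀ`.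
  have hprod : hermitePoly a (1 - a ^ 2) n * hermiteNum a * (hermitePoly a (1 - a ^ 2) k)ᵀ =
      !![Polynomial.C (1 - a ^ 2) * (H n * H k) +
          Polynomial.C (a ^ 2 / 4) * (H (n + 1) * H (k + 1)),
        Polynomial.C (-(a * (1 - a ^ 2) * k)) * (H n * H (k - 1)) +
          Polynomial.C (a * (1 - a ^ 2) / 2) * (H (n + 1) * H k);
        Polynomial.C (-(a * (1 - a ^ 2) * n)) * (H (n - 1) * H k) +
          Polynomial.C (a * (1 - a ^ 2) / 2) * (H n * H (k + 1)),
        Polynomial.C ((1 - a ^ 2) * a ^ 2 * n * k) * (H (n - 1) * H (k - 1)) +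
          Polynomial.C ((1 - a ^ 2) ^ 2) * (H n * H k)] := by
    refine matPoly_ext fun t => ?_
    have h : ∀ n : ℕ, (H (n + 1)).eval t = 2 * t * (H n).eval t
        - 2 * (n * (H (n - 1)).eval t) := fun n => by
      have := congrArg (Polynomial.eval t) (H_two_X_mul n)
      simp at this
      linarith
    rw [evalAt_mul, evalAt_mul, evalAt_transpose, evalAt_hermitePoly, evalAt_hermitePoly,
      evalAt_hermiteNum]
    ext i j; fin_cases i <;> fin_cases j <;>
      simp [evalAt, Matrix.mul_apply, Fin.sum_univ_two, h] <;> ring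
  ext i j
  rw [form_hermiteWeight_apply, hprod]
  fin_cases i <;> fin_cases j <;>
    simp only [Matrix.of_apply, Fin.mk_one, Fin.zero_eta,
      Matrix.cons_val_zero, Matrix.cons_val_one, Matrix.cons_val_fin_one, key]
  · by_cases h : n = k
    · subst h
      simp [Nat.factorial_succ]; ring
    · simp [h]
  · by_cases h : n = k
    · subst h
      -- At `n = 0` the indices `n` and `n - 1` coincide, but that term carries the factor `n`;
      -- otherwise no indices match.
      cases n <;> simp
    · cases k with
      | zero => simp [h]
      | succ k =>
        by_cases h' : n = k
        · subst h'
          -- At `k = n + 1` both terms survive and cancel, since the squared norm of `H_{n+1}` is `2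
          -- (n + 1)` times that of `H_n`.
          simp [Nat.factorial_succ]; ring
        · simp [h, h']
  · by_cases h : n = k
    · subst h
      cases n <;> simp
    · cases n with
      | zero => simp [h]
      | succ n =>
        by_cases h' : n = k
        · subst h'
          simp [Nat.factorial_succ]; ring
        · simp [h, h']
  · by_cases h : n = k
    · subst h
      cases n with
      | zero => simp; ring
      | succ n => simp [Nat.factorial_succ]; ring
    · cases n <;> cases k <;> simp_all

/-! ### Orthogonality of the exceptional polynomials -/

theorem pfrak_eq (a : ℝ) : pfrak a =
    Polynomial.C (2 * (2 - a ^ 2)) * Polynomial.X ^ 2 - Polynomial.C (a ^ 2) := by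
  refine Polynomial.funext fun t => ?_
  rw [pfrak_eval]
  simp [-map_sub, -map_pow, -map_mul]

theorem derivative_pfrak_eval (a t : ℝ) :
    (Polynomial.derivative (pfrak a)).eval t = 4 * (2 - a ^ 2) * t := by
  rw [pfrak_eq]
  simp [-map_sub, -map_pow, -map_mul]; ring

/-- In terms of the weights, `F 𝒲 = W Kᵀ / 𝔭`: it turns the first order part of `𝒜` into something
that can be integrated by parts against `W`. -/
theorem darbouxFactor_mul_excNum {a : ℝ} (ha : 2 < a ^ 2) :
    darbouxFactor a * excNum a = pfrak a • (hermiteNum a * (adjCoeff a)ᵀ) := by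
  have hc : a ^ 2 - 2 ≠ 0 := by linarith
  refine matPoly_ext fun t => ?_
  rw [evalAt_smul, evalAt_mul, evalAt_mul, evalAt_darbouxFactor, evalAt_excNum, evalAt_hermiteNum,
    evalAt_adjCoeff_transpose, pfrak_eval]
  ext i j; fin_cases i <;> fin_cases j <;> simp [Matrix.mul_apply, Fin.sum_univ_two]
  all_goals field_simp
  all_goals ring

/-- A Pearson equation: divided by `𝔭²` and multiplied by `e^{-t²}`, it says `(W Kᵀ / 𝔭)' + 𝒲 = -W
D`. -/
theorem pearson_excNum {a : ℝ} (ha : 2 < a ^ 2) :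
    pfrak a • (der (hermiteNum a * (adjCoeff a)ᵀ)
        - (2 * Polynomial.X : ℝ[X]) • (hermiteNum a * (adjCoeff a)ᵀ))
      - Polynomial.derivative (pfrak a) • (hermiteNum a * (adjCoeff a)ᵀ) + excNum a =
    -(pfrak a ^ 2 • (hermiteNum a * const (eigenDiag a))) := by
  have hc : a ^ 2 - 2 ≠ 0 := by linarith
  refine matPoly_ext fun t => ?_
  have hd : evalAt (der (hermiteNum a)) t = !![2 * a ^ 2 * t, a; a, 0] := by
    ext i j; fin_cases i <;> fin_cases j <;>
      simp [evalAt, der, hermiteNum, -map_sub, -map_pow]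
    ring
  have hd' : evalAt (der (adjCoeff a)ᵀ) t =
      !![1 / (a ^ 2 - 2), 0; -(a / (a ^ 2 - 2)) * (a ^ 2 * t),
        2 * (a ^ 2 - 1) / (a ^ 2 - 2) ^ 2] := by
    ext i j; fin_cases i <;> fin_cases j <;>
      simp [evalAt, der, adjCoeff, -map_sub, -map_pow, -map_mul]
    field_simp
    ring
  simp only [der_mul, evalAt_add, evalAt_sub, evalAt_neg, evalAt_smul, evalAt_mul, evalAt_const,
    hd, hd', evalAt_adjCoeff_transpose, evalAt_hermiteNum, evalAt_excNum, derivative_pfrak_eval,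
    Polynomial.eval_pow, pfrak_eval]
  ext i j; fin_cases i <;> fin_cases j <;>
    simp [eigenDiag]
  all_goals field_simp
  all_goals ring

theorem der_transpose {N : ℕ} (P : MatPoly N) : der Pᵀ = (der P)ᵀ := rfl

theorem eigenDiag_transpose (a : ℝ) : (eigenDiag a)ᵀ = eigenDiag a := by
  ext i j; fin_cases i <;> fin_cases j <;> simp [eigenDiag]

theorem const_transpose {N : ℕ} (A : Matrix (Fin N) (Fin N) ℝ) :
    (const A)ᵀ = const Aᵀ := rfl

/-- The integrand of `⟨𝒫_n, 𝒫_k⟩` is the one of `⟨P_n, P_k⟩` times a constant matrix, up to a total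
derivative. -/
theorem excPoly_lagrange {a : ℝ} (ha : 2 < a ^ 2) (n k : ℕ) :
    excPoly a n * excNum a * (excPoly a k)ᵀ =
      pfrak a ^ 2 • (hermitePoly a (1 - a ^ 2) n * hermiteNum a * (hermitePoly a (1 - a ^ 2) k)ᵀ
        * const (((k : ℝ) - 1) • eigenDiag a)) +
      (pfrak a • (der (hermitePoly a (1 - a ^ 2) n * (hermiteNum a * (adjCoeff a)ᵀ)
            * (excPoly a k)ᵀ)
          - (2 * Polynomial.X : ℝ[X]) •
            (hermitePoly a (1 - a ^ 2) n * (hermiteNum a * (adjCoeff a)ᵀ) * (excPoly a k)ᵀ))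
        - Polynomial.derivative (pfrak a) •
          (hermitePoly a (1 - a ^ 2) n * (hermiteNum a * (adjCoeff a)ᵀ) * (excPoly a k)ᵀ)) := by
  have h0 := congrArg Matrix.transpose (adjoint_excPoly ha k)
  have h1 := darbouxFactor_mul_excNum ha
  have h2 := pearson_excNum ha
  have h3 := excPoly_eq ha n
  rw [Matrix.transpose_sub, Matrix.transpose_smul, Matrix.transpose_smul, Matrix.transpose_mul,
    Matrix.transpose_mul, Matrix.transpose_mul, const_transpose, const_transpose,
    Matrix.transpose_smul, eigenDiag_transpose] at h0
  rw [h3, der_mul, der_mul, der_transpose]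
  generalize hermitePoly a (1 - a ^ 2) n = y at *
  generalize (hermitePoly a (1 - a ^ 2) k)ᵀ = z at *
  generalize const (((k : ℝ) - 1) • eigenDiag a) = Γ at *
  generalize const (eigenDiag a) = D at *
  generalize Polynomial.derivative (pfrak a) = p' at *
  generalize pfrak a = p at *
  generalize (excPoly a k)ᵀ = Q at *
  generalize (der (excPoly a k))ᵀ = Q' at *
  have h4 : p ^ 2 • (y * hermiteNum a * z * Γ) = p • (y * hermiteNum a * (p • (z * Γ))) := by
    rw [Matrix.mul_smul, smul_smul, Matrix.mul_assoc _ z, sq]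
  have h5 : der y * darbouxFactor a * excNum a * Q =
      der y * (p • (hermiteNum a * (adjCoeff a)ᵀ)) * Q := by
    rw [Matrix.mul_assoc (der y), h1]
  have h6 := congrArg (fun M => y * M * Q) h2
  simp only [Matrix.mul_add, Matrix.mul_sub, Matrix.sub_mul, Matrix.add_mul, Matrix.smul_mul,
    Matrix.mul_smul, Matrix.mul_neg, Matrix.neg_mul, smul_sub] at h6
  have h7 : y * excNum a * Q = -(p ^ 2 • (y * (hermiteNum a * D) * Q))
      - (p • (y * der (hermiteNum a * (adjCoeff a)ᵀ) * Q)
        - p • (2 * Polynomial.X : ℝ[X]) • (y * (hermiteNum a * (adjCoeff a)ᵀ) * Q)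
        - p' • (y * (hermiteNum a * (adjCoeff a)ᵀ) * Q)) := by
    rw [← h6]; abel
  rw [h4, ← h0, Matrix.sub_mul, Matrix.sub_mul, h5, h7]
  simp only [Matrix.mul_sub, Matrix.add_mul, Matrix.smul_mul, Matrix.mul_smul, Matrix.mul_assoc]
  module

/-- The adjoint relation between `𝒜` and its partner operator: integrating the pointwise Lagrange
identity kills the total derivative. -/
theorem form_excPoly {a : ℝ} (ha : 2 < a ^ 2) (n k : ℕ) :
    form (excWeight a) (excPoly a n) (excPoly a k) =
      form (hermiteWeight a (1 - a ^ 2)) (hermitePoly a (1 - a ^ 2) n)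
        (hermitePoly a (1 - a ^ 2) k) * (((k : ℝ) - 1) • eigenDiag a) := by
  ext i j
  rw [form_excWeight_apply, excPoly_lagrange ha, Matrix.mul_apply, Fin.sum_univ_two,
    form_hermiteWeight_apply, form_hermiteWeight_apply]
  set L := hermitePoly a (1 - a ^ 2) n * (hermiteNum a * (adjCoeff a)ᵀ) * (excPoly a k)ᵀ with hL
  set M := hermitePoly a (1 - a ^ 2) n * hermiteNum a * (hermitePoly a (1 - a ^ 2) k)ᵀ with hM
  set Γ := ((k : ℝ) - 1) • eigenDiag a with hΓ
  have i1 : ∀ l, Integrable fun t : ℝ => (M i l).eval t * Real.exp (-t ^ 2) * Γ l j :=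
    fun l => (integrable_eval_mul_exp _).mul_const _
  have i2 := integrable_eval_mul_exp_div ha (pfrak a * (Polynomial.derivative (L i j)
    - 2 * Polynomial.X * L i j) - Polynomial.derivative (pfrak a) * L i j) 2
  -- The zero added on the right is replaced by the integral of the total derivative, so that the
  -- integrands can be compared pointwise.
  rw [← integral_mul_const, ← integral_mul_const, ← integral_add (i1 0) (i1 1),
    ← add_zero (∫ t : ℝ, _ + _), ← integral_derivative_mul_exp_div ha (L i j)]
  refine Eq.trans ?_ (integral_add ((i1 0).add (i1 1)) i2)
  congr 1 with t
  have hp := pfrak_eval_ne_zero ha t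
  simp only [Matrix.add_apply, Matrix.sub_apply, Matrix.smul_apply, Matrix.mul_apply (M := M),
    Fin.sum_univ_two, smul_eq_mul, Polynomial.eval_add, Polynomial.eval_mul, Polynomial.eval_sub,
    Polynomial.eval_pow, const, Matrix.map_apply, Polynomial.eval_C, der_apply]
  field_simp

/-! ### Positivity of the weight -/

/-- Complete the square in the second variable. The lower right entry is the pivot because for the
weight it is visibly positive. -/
theorem posDef_of_fin_two {M : Matrix (Fin 2) (Fin 2) ℝ} (hs : M 0 1 = M 1 0) (h1 : 0 < M 1 1)
    (hd : 0 < M.det) : M.PosDef := by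
  rw [Matrix.det_fin_two] at hd
  refine Matrix.PosDef.of_dotProduct_mulVec_pos ?_ fun x hx => ?_
  · ext i j; fin_cases i <;> fin_cases j <;> simp [hs]
  · have e : star x ⬝ᵥ (M *ᵥ x) =
        M 0 0 * x 0 ^ 2 + 2 * M 1 0 * x 0 * x 1 + M 1 1 * x 1 ^ 2 := by
      simp [Matrix.mulVec, dotProduct, Fin.sum_univ_two, hs]; ring
    rw [e]
    have key : M 1 1 * (M 0 0 * x 0 ^ 2 + 2 * M 1 0 * x 0 * x 1 + M 1 1 * x 1 ^ 2) =
        (M 1 1 * x 1 + M 1 0 * x 0) ^ 2 + (M 0 0 * M 1 1 - M 0 1 * M 1 0) * x 0 ^ 2 := by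
      rw [hs]; ring
    refine pos_of_mul_pos_right (a := M 1 1) ?_ h1.le
    rw [key]
    by_cases h0 : x 0 = 0
    · have h2 : x 1 ≠ 0 := fun h2 => hx (by ext i; fin_cases i <;> assumption)
      rw [h0]; simp only [mul_zero, add_zero]
      have := mul_ne_zero h1.ne' h2
      positivity
    · positivity

/-- A factor `𝔭²` splits off and the rest is a positive constant, so positivity of the determinant
is immediate. -/
theorem excNum_det {a : ℝ} (ha : 2 < a ^ 2) (t : ℝ) :
    (evalAt (excNum a) t).det =
      (pfrak a).eval t ^ 2 * ((a ^ 2 - 1) / (2 * (a ^ 2 - 2))) := by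
  have hc : a ^ 2 - 2 ≠ 0 := by linarith
  rw [evalAt_excNum, Matrix.det_fin_two_of, pfrak_eval]
  field_simp
  ring

theorem excWeight_posDef {a : ℝ} (ha : 2 < a ^ 2) (t : ℝ) : (excWeight a t).PosDef := by
  have hp := pfrak_eval_ne_zero ha t
  have hc : 0 < a ^ 2 - 2 := by linarith
  have hb : 0 < a ^ 2 - 1 := by linarith
  have hs : 0 < Real.exp (-t ^ 2) / (pfrak a).eval t ^ 2 := by positivity
  rw [excWeight_eq]
  refine posDef_of_fin_two ?_ ?_ ?_
  · simp [evalAt_excNum]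
  · have : 0 < a ^ 2 * (a ^ 2 - 2) - (pfrak a).eval t := by
      nlinarith [pfrak_eval_le ha t]
    rw [Matrix.smul_apply, evalAt_excNum, smul_eq_mul]
    simp only [Matrix.of_apply, Matrix.cons_val_one, Matrix.cons_val_fin_one]
    positivity
  · rw [Matrix.det_smul, excNum_det ha]
    positivity

theorem excWeight_apply (a t : ℝ) (i j : Fin 2) :
    excWeight a t i j = (excNum a i j).eval t * Real.exp (-t ^ 2) / (pfrak a).eval t ^ 2 := by
  rw [excWeight_eq, Matrix.smul_apply, evalAt_apply, smul_eq_mul]; ring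

theorem integrable_excWeight {a : ℝ} (ha : 2 < a ^ 2) (i j : Fin 2) :
    Integrable fun t => excWeight a t i j := by
  simp only [excWeight_apply]
  exact integrable_eval_mul_exp_div ha _ 2

theorem continuous_excWeight {a : ℝ} (ha : 2 < a ^ 2) (i j : Fin 2) :
    Continuous fun t => excWeight a t i j := by
  simp only [excWeight_apply]
  exact Continuous.div (by fun_prop) (by fun_prop) fun t => pow_ne_zero 2 (pfrak_eval_ne_zero ha t)

theorem dotProduct_mass_mulVec {N : ℕ} {W : ℝ → Matrix (Fin N) (Fin N) ℝ}
    (hW : ∀ i j, Integrable fun t => W t i j) (Ω : Set ℝ) (x : Fin N → ℝ) :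
    star x ⬝ᵥ (mass W Ω *ᵥ x) = ∫ t in Ω, star x ⬝ᵥ (W t *ᵥ x) := by
  have hi : ∀ i j, Integrable (fun t => x i * (W t i j * x j)) (volume.restrict Ω) :=
    fun i j => (((hW i j).mul_const _).const_mul _).restrict
  simp only [dotProduct, Matrix.mulVec, mass, Matrix.of_apply, Pi.star_apply, star_trivial,
    Finset.mul_sum]
  rw [integral_finsetSum _ fun i _ => integrable_finsetSum _ fun j _ => hi i j]
  refine Finset.sum_congr rfl fun i _ => ?_
  rw [integral_finsetSum _ fun j _ => hi i j]
  refine Finset.sum_congr rfl fun j _ => ?_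
  rw [integral_const_mul, integral_mul_const]

theorem mass_isHermitian {N : ℕ} {W : ℝ → Matrix (Fin N) (Fin N) ℝ}
    (hW : ∀ t, (W t).IsHermitian) (Ω : Set ℝ) : (mass W Ω).IsHermitian := by
  ext i j
  simp only [Matrix.conjTranspose_apply, mass, Matrix.of_apply, star_trivial]
  congr 1 with t
  simpa using (hW t).apply i j

theorem excWeight_isWeightMatrix {a : ℝ} (ha : 2 < a ^ 2) : IsWeightMatrix (excWeight a) where
  moments k i j := by
    refine (integrable_eval_mul_exp_div ha (Polynomial.X ^ k * excNum a i j) 2).congr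
      (Filter.Eventually.of_forall fun t => ?_)
    simp only [excWeight_apply]
    simp only [Polynomial.eval_mul, Polynomial.eval_pow, Polynomial.eval_X]
    ring
  posSemidef Ω _ := by
    refine Matrix.PosSemidef.of_dotProduct_mulVec_nonneg
      (mass_isHermitian (fun t => (excWeight_posDef ha t).isHermitian) Ω) fun x => ?_
    rw [dotProduct_mass_mulVec (integrable_excWeight ha)]
    exact integral_nonneg fun t => (excWeight_posDef ha t).posSemidef.dotProduct_mulVec_nonneg x
  posDef := by
    refine ⟨Set.univ, MeasurableSet.univ, Matrix.PosDef.of_dotProduct_mulVec_pos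
      (mass_isHermitian (fun t => (excWeight_posDef ha t).isHermitian) _) fun x hx => ?_⟩
    rw [dotProduct_mass_mulVec (integrable_excWeight ha), setIntegral_univ]
    have hc : Continuous fun t => star x ⬝ᵥ (excWeight a t *ᵥ x) := by
      simp only [dotProduct, Matrix.mulVec]
      refine continuous_finsetSum _ fun i _ => continuous_const.mul ?_
      exact continuous_finsetSum _ fun j _ => (continuous_excWeight ha i j).mul continuous_const
    have hi : Integrable fun t => star x ⬝ᵥ (excWeight a t *ᵥ x) := by
      simp only [dotProduct, Matrix.mulVec]
      refine integrable_finsetSum _ fun i _ => Integrable.const_mul ?_ _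
      exact integrable_finsetSum _ fun j _ => (integrable_excWeight ha i j).mul_const _
    exact integral_pos_of_integrable_nonneg_nonzero (x := 0) hc hi
      (fun t => (excWeight_posDef ha t).posSemidef.dotProduct_mulVec_nonneg x)
      ((excWeight_posDef ha 0).dotProduct_mulVec_pos hx).ne'

/-- `‖𝒫_n‖²` is positive definite. -/
theorem form_excPoly_posDef {a : ℝ} (ha : 2 < a ^ 2) {n : ℕ} (hn : n ≠ 1) :
    (form (excWeight a) (excPoly a n) (excPoly a n)).PosDef := by
  have hc : 0 < a ^ 2 - 2 := by linarith
  have hξ : 1 - a ^ 2 < 0 := by linarith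
  set S := Real.sqrt Real.pi * 2 ^ n * (n.factorial : ℝ) with hS
  have hS0 : 0 < S := by positivity
  set u := (1 - a ^ 2) + a ^ 2 * ((n : ℝ) + 1) / 2 with hu
  set v := (1 - a ^ 2) + a ^ 2 * (n : ℝ) / 2 with hv
  -- For `n = 0` both `u` and `v` are negative, as is `n - 1`; for `n ≥ 2` all three are positive.
  -- The remaining negative factor `1 - a²` meets the negative second entry of `D`.
  have hsign : 0 < ((n : ℝ) - 1) * u ∧ 0 < ((n : ℝ) - 1) * v := by
    rcases n with _ | _ | n
    · simp only [hu, hv]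
      constructor <;> push_cast <;> nlinarith
    · exact absurd rfl hn
    · simp only [hu, hv]
      push_cast
      have h0 : (0 : ℝ) ≤ n := n.cast_nonneg
      have : 0 ≤ a ^ 2 * (n : ℝ) := by positivity
      constructor <;> refine mul_pos (by linarith) ?_ <;> nlinarith
  have key : form (excWeight a) (excPoly a n) (excPoly a n) =
      Matrix.diagonal ![S * (((n : ℝ) - 1) * u) * (1 / (2 * (a ^ 2 - 2))),
        S * (((n : ℝ) - 1) * v) * (-(1 - a ^ 2)) * (1 / (a ^ 2 - 2) ^ 2)] := by
    rw [form_excPoly ha, form_hermitePoly, if_pos rfl]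
    ext i j; fin_cases i <;> fin_cases j <;>
      simp [Matrix.mul_apply, Fin.sum_univ_two, eigenDiag]
    all_goals ring
  rw [key, Matrix.posDef_diagonal_iff]
  intro i
  fin_cases i
  · exact mul_pos (mul_pos hS0 hsign.1) (by positivity)
  · exact mul_pos (mul_pos (mul_pos hS0 hsign.2) (by linarith)) (by positivity)

/-! ### Density of the polynomials for measures with exponential moments -/

theorem integrable_exp_mul_abs_of_forall {μ : Measure ℝ}
    (hμ : ∀ c : ℝ, Integrable (fun x => Real.exp (c * x)) μ) (c : ℝ) : Integrable (fun x => Real.exp (c * |x|)) μ := by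
  refine ((hμ c).add (hμ (-c))).mono' (by fun_prop) (Filter.Eventually.of_forall fun x => ?_)
  rw [Real.norm_eq_abs, Real.abs_exp, Pi.add_apply]
  rcases abs_choice x with h | h <;> rw [h]
  · exact le_add_of_nonneg_right (Real.exp_pos _).le
  · rw [mul_neg, ← neg_mul]
    exact le_add_of_nonneg_left (Real.exp_pos _).le

theorem memLp_exp_mul_abs {μ : Measure ℝ}
    (hμ : ∀ c : ℝ, Integrable (fun x => Real.exp (c * x)) μ) (c : ℝ) : MemLp (fun x => Real.exp (c * |x|)) 2 μ := by
  rw [memLp_two_iff_integrable_sq (by fun_prop)]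
  convert integrable_exp_mul_abs_of_forall hμ (2 * c) using 2 with x
  rw [← Real.exp_nat_mul]; push_cast; ring_nf

theorem memLp_eval {μ : Measure ℝ}
    (hμ : ∀ c : ℝ, Integrable (fun x => Real.exp (c * x)) μ) (q : ℝ[X]) : MemLp (fun x => q.eval x) 2 μ := by
  induction q using Polynomial.induction_on' with
  | add p q hp hq => 
    simp only [Polynomial.eval_add]
    exact hp.add hq
  | monomial n c =>
    refine ((memLp_exp_mul_abs hμ 1).const_mul (|c| * n.factorial)).mono
      (by fun_prop) (Filter.Eventually.of_forall fun x => ?_)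
    have h := Real.pow_div_factorial_le_exp |x| (abs_nonneg x) n
    rw [div_le_iff₀ (by positivity)] at h
    simp only [Polynomial.eval_monomial, Real.norm_eq_abs, abs_mul, abs_pow, abs_abs,
      Real.abs_exp, Nat.abs_cast, one_mul]
    rw [mul_assoc]
    exact mul_le_mul_of_nonneg_left (by linarith) (abs_nonneg c)

/-- Expand the exponential and integrate term by term; the series is dominated by `|f| e^{|s||x|}`,
a product of two square integrable functions. -/
theorem integral_mul_cexp_eq_zero {μ : Measure ℝ}
    (hμ : ∀ c : ℝ, Integrable (fun x => Real.exp (c * x)) μ) {f : ℝ → ℝ} (hf : MemLp f 2 μ)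
    (h0 : ∀ n : ℕ, ∫ x, f x * x ^ n ∂μ = 0) (s : ℝ) :
    ∫ x, (f x : ℂ) * Complex.exp (s * x * Complex.I) ∂μ = 0 := by
  have hint : Integrable (fun x => |f x| * Real.exp (|s| * |x|)) μ :=
    hf.abs.integrable_mul (memLp_exp_mul_abs hμ |s|)
  have hreal : ∀ y : ℝ, HasSum (fun n : ℕ => y ^ n / (n.factorial : ℝ)) (Real.exp y) := fun y => by
    rw [Real.exp_eq_exp_ℝ]
    exact NormedSpace.expSeries_div_hasSum_exp y
  have hsum := hasSum_integral_of_dominated_convergence (μ := μ)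
    (F := fun (n : ℕ) (x : ℝ) => (f x : ℂ) * ((s * x * Complex.I) ^ n / (n.factorial : ℂ)))
    (f := fun x => (f x : ℂ) * Complex.exp (s * x * Complex.I))
    (fun (n : ℕ) (x : ℝ) => |f x| * ((|s| * |x|) ^ n / (n.factorial : ℝ)))
    (fun n => ?_) (fun n => Filter.Eventually.of_forall fun x => ?_)
    (Filter.Eventually.of_forall fun x => ((hreal _).mul_left _).summable) ?_
    (Filter.Eventually.of_forall fun x => ?_)
  · refine hsum.unique ?_
    convert hasSum_zero with n
    have e : ∀ x : ℝ, (f x : ℂ) * ((s * x * Complex.I) ^ n / (n.factorial : ℂ)) =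
        ((s * Complex.I) ^ n / (n.factorial : ℂ)) * ((f x * x ^ n : ℝ) : ℂ) := fun x => by
      push_cast; ring
    simp only [e]
    rw [integral_const_mul, integral_complex_ofReal, h0 n]
    simp
  · have h1 : AEStronglyMeasurable (fun x => (f x : ℂ)) μ :=
      Complex.continuous_ofReal.comp_aestronglyMeasurable hf.1
    exact h1.mul (Continuous.aestronglyMeasurable (by fun_prop))
  · simp
  · simpa only [((hreal _).mul_left _).tsum_eq] using hint
  · refine HasSum.mul_left _ ?_
    rw [Complex.exp_eq_exp_ℂ]
    exact NormedSpace.expSeries_div_hasSum_exp _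

/-- The positive and negative parts of `f` are densities of two finite measures with the same
characteristic function, hence equal. -/
theorem ae_eq_zero_of_moments {μ : Measure ℝ}
    (hμ : ∀ c : ℝ, Integrable (fun x => Real.exp (c * x)) μ) {f : ℝ → ℝ} (hm : Measurable f) (hf : MemLp f 2 μ)
    (h0 : ∀ n : ℕ, ∫ x, f x * x ^ n ∂μ = 0) : f =ᵐ[μ] 0 := by
  have : IsFiniteMeasure μ := by
    have := hμ 0
    simp only [zero_mul, Real.exp_zero] at this
    exact (integrable_const_iff_isFiniteMeasure one_ne_zero).1 this
  have hfi : Integrable f μ := hf.integrable (by norm_num)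
  have hpos : ∀ g : ℝ → ℝ, Integrable g μ → ∫⁻ x, ENNReal.ofReal (g x) ∂μ ≠ ∞ := fun g hg =>
    hg.lintegral_lt_top.ne
  have := isFiniteMeasure_withDensity (hpos f hfi)
  have := isFiniteMeasure_withDensity (hpos (fun x => -f x) hfi.neg)
  have hchar : ∀ (g : ℝ → ℝ), Measurable g → ∀ s : ℝ,
      charFun (μ.withDensity fun x => ENNReal.ofReal (g x)) s =
        ∫ x, ((max (g x) 0 : ℝ) : ℂ) * Complex.exp (s * x * Complex.I) ∂μ := fun g hg s => by
    rw [charFun_apply_real, integral_withDensity_eq_integral_toReal_smul (by fun_prop)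
      (Filter.Eventually.of_forall fun x => ENNReal.ofReal_lt_top)]
    congr 1
  have hinteg : ∀ (g : ℝ → ℝ), Integrable g μ → ∀ s : ℝ,
      Integrable (fun x => ((max (g x) 0 : ℝ) : ℂ) * Complex.exp (s * x * Complex.I)) μ :=
    fun g hg s => by
    have h1 : Integrable (fun x => ((max (g x) 0 : ℝ) : ℂ)) μ := hg.pos_part.ofReal
    refine h1.mul_bdd (c := 1) (Continuous.aestronglyMeasurable (by fun_prop))
      (Filter.Eventually.of_forall fun x => ?_)
    rw [← Complex.ofReal_mul, Complex.norm_exp_ofReal_mul_I]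
  have heq : (μ.withDensity fun x => ENNReal.ofReal (f x)) =
      μ.withDensity fun x => ENNReal.ofReal (-f x) := by
    refine Measure.ext_of_charFun (funext fun s => ?_)
    rw [hchar f hm, hchar (fun x => -f x) hm.neg, ← sub_eq_zero,
      ← integral_sub (hinteg f hfi s) (hinteg (fun x => -f x) hfi.neg s), ← integral_mul_cexp_eq_zero hμ hf h0 s]
    congr 1 with x
    rw [← sub_mul, ← Complex.ofReal_sub]
    congr 2
    rcases le_total 0 (f x) with h | h
    · rw [max_eq_left h, max_eq_right (by linarith), sub_zero]
    · rw [max_eq_right h, max_eq_left (by linarith)]; ring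
  rw [withDensity_eq_iff (by fun_prop) (by fun_prop) (hpos f hfi)] at heq
  filter_upwards [heq] with x hx
  rcases le_total 0 (f x) with h | h
  · rw [ENNReal.ofReal_of_nonpos (p := -f x) (by linarith), ENNReal.ofReal_eq_zero] at hx
    exact le_antisymm hx h
  · rw [ENNReal.ofReal_of_nonpos h, eq_comm, ENNReal.ofReal_eq_zero] at hx
    exact le_antisymm h (neg_nonpos.1 hx)

theorem exists_polynomial_eLpNorm_sub_lt {μ : Measure ℝ}
    (hμ : ∀ c : ℝ, Integrable (fun x => Real.exp (c * x)) μ) {f : ℝ → ℝ} (hf : MemLp f 2 μ) {ε : ℝ≥0∞} (hε : 0 < ε) :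
    ∃ q : ℝ[X], eLpNorm (fun x => f x - q.eval x) 2 μ < ε := by
  let φ : ℝ[X] →ₗ[ℝ] Lp ℝ 2 μ :=
    { toFun := fun q => (memLp_eval hμ q).toLp _
      map_add' := fun p q => by
        rw [← MemLp.toLp_add]
        exact MemLp.toLp_congr _ _ (Filter.Eventually.of_forall fun x => by simp)
      map_smul' := fun c q => by
        rw [RingHom.id_apply, ← MemLp.toLp_const_smul]
        exact MemLp.toLp_congr _ _ (Filter.Eventually.of_forall fun x => by simp) }
  -- In a Hilbert space density means a trivial orthogonal complement, and orthogonality to the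
  -- monomials is vanishing of all moments.
  have hdense : (LinearMap.range φ).topologicalClosure = ⊤ := by
    rw [Submodule.topologicalClosure_eq_top_iff, Submodule.eq_bot_iff]
    intro g hg
    rw [Submodule.mem_orthogonal] at hg
    rw [Lp.eq_zero_iff_ae_eq_zero]
    refine ae_eq_zero_of_moments hμ (Lp.stronglyMeasurable g).measurable (Lp.memLp g) fun n => ?_
    have h := hg (φ (Polynomial.X ^ n)) ⟨_, rfl⟩
    rw [L2.inner_def] at h
    rw [← h]
    refine integral_congr_ae ?_
    filter_upwards [(memLp_eval hμ (Polynomial.X ^ n)).coeFn_toLp] with x hx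
    have hx' : (φ (Polynomial.X ^ n) : ℝ → ℝ) x = x ^ n :=
      hx.trans (by simp)
    rw [hx']
    simp
  have hmem : hf.toLp f ∈ closure (LinearMap.range φ : Set (Lp ℝ 2 μ)) := by
    rw [← Submodule.topologicalClosure_coe, hdense]; trivial
  rw [Metric.mem_closure_iff] at hmem
  obtain ⟨δ, hδ0, hδ⟩ := ENNReal.lt_iff_exists_nnreal_btwn.mp hε
  obtain ⟨_, ⟨q, rfl⟩, hq⟩ := hmem δ (by exact_mod_cast hδ0)
  refine ⟨q, lt_trans ?_ hδ⟩
  rw [Lp.dist_def] at hq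
  have e : eLpNorm (⇑(hf.toLp f) - ⇑(φ q)) 2 μ = eLpNorm (fun x => f x - q.eval x) 2 μ := by
    refine eLpNorm_congr_ae ?_
    filter_upwards [hf.coeFn_toLp, (memLp_eval hμ q).coeFn_toLp] with x h1 h2
    have h2' : (φ q : ℝ → ℝ) x = q.eval x := h2
    rw [Pi.sub_apply, h1, h2']
  rw [e] at hq
  have hfin : eLpNorm (fun x => f x - q.eval x) 2 μ ≠ ∞ := (hf.sub (memLp_eval hμ q)).2.ne
  rw [← ENNReal.ofReal_toReal hfin, ← ENNReal.ofReal_coe_nnreal]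
  exact (ENNReal.ofReal_lt_ofReal_iff (by exact_mod_cast hδ0)).2 hq

theorem exists_polynomial_lintegral_lt {g : ℝ → ℝ}
    (hg : MemLp g 2 (ProbabilityTheory.gaussianReal 0 1)) {ε : ℝ≥0∞} (hε : 0 < ε) :
    -- The standard normal density is `e^{-t²/2}` divided by `√(2π)`, which is the constant `K`
    -- below.
    ∃ q : ℝ[X], ∫⁻ t : ℝ, ENNReal.ofReal (Real.exp (-t ^ 2 / 2) * (g t - q.eval t) ^ 2) < ε := by
  set K : ℝ≥0∞ := ENNReal.ofReal (Real.sqrt (2 * Real.pi)) with hK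
  obtain ⟨δ, hδ0, hδ⟩ := ENNReal.exists_nnreal_pos_mul_lt
    (show K ≠ ∞ from ENNReal.ofReal_ne_top) hε.ne'
  obtain ⟨q, hq⟩ := exists_polynomial_eLpNorm_sub_lt
    ProbabilityTheory.integrable_exp_mul_gaussianReal hg
    (show (0 : ℝ≥0∞) < (NNReal.sqrt δ : ℝ≥0∞) by simpa using hδ0)
  refine ⟨q, lt_of_le_of_lt ?_ hδ⟩
  have h1 : ∫⁻ t, ‖g t - q.eval t‖ₑ ^ (2 : ℝ) ∂(ProbabilityTheory.gaussianReal 0 1) ≤ δ := by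
    have h := eLpNorm_nnreal_pow_eq_lintegral (f := fun x => g x - q.eval x)
      (μ := ProbabilityTheory.gaussianReal 0 1) (p := 2) two_ne_zero
    simp only [NNReal.coe_ofNat, ENNReal.coe_ofNat] at h
    rw [← h]
    refine (ENNReal.rpow_le_rpow hq.le (by norm_num)).trans ?_
    rw [ENNReal.rpow_ofNat, ← ENNReal.coe_pow, NNReal.sq_sqrt]
  have h2 : ∫⁻ t : ℝ, ENNReal.ofReal (Real.exp (-t ^ 2 / 2) * (g t - q.eval t) ^ 2) =
      K * ∫⁻ t, ‖g t - q.eval t‖ₑ ^ (2 : ℝ) ∂(ProbabilityTheory.gaussianReal 0 1) := by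
    rw [ProbabilityTheory.gaussianReal_of_var_ne_zero 0 one_ne_zero,
      lintegral_withDensity_eq_lintegral_mul_non_measurable _
        (ProbabilityTheory.measurable_gaussianPDF 0 1)
        (Filter.Eventually.of_forall fun x => ProbabilityTheory.gaussianPDF_lt_top),
      ← lintegral_const_mul' _ _ ENNReal.ofReal_ne_top]
    congr 1 with t
    rw [Pi.mul_apply, ProbabilityTheory.gaussianPDF, ProbabilityTheory.gaussianPDFReal,
      Real.enorm_eq_ofReal_abs, ENNReal.rpow_ofNat, ← ENNReal.ofReal_pow (abs_nonneg _),
      ← ENNReal.ofReal_mul (by positivity), ← ENNReal.ofReal_mul (by positivity), sq_abs]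
    congr 1
    have : Real.sqrt (2 * Real.pi) ≠ 0 := by positivity
    simp only [NNReal.coe_one, mul_one, sub_zero]
    field_simp
  rw [h2, mul_comm]
  gcongr

/-! ### Quadratic forms -/

theorem trace_mul_mul_transpose_nonneg {V : Matrix (Fin N) (Fin N) ℝ} (hV : V.PosSemidef)
    (A : Matrix (Fin N) (Fin N) ℝ) : 0 ≤ (A * V * Aᵀ).trace := by
  have h := (hV.mul_mul_conjTranspose_same A).trace_nonneg
  rwa [Matrix.conjTranspose_eq_transpose_of_trivial] at h

/-- The parallelogram law, dropping the nonnegative term of `A - B`. -/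
theorem trace_add_mul_mul_transpose_le {V : Matrix (Fin N) (Fin N) ℝ} (hV : V.PosSemidef)
    (A B : Matrix (Fin N) (Fin N) ℝ) :
    ((A + B) * V * (A + B)ᵀ).trace ≤
      2 * (A * V * Aᵀ).trace + 2 * (B * V * Bᵀ).trace := by
  have h := trace_mul_mul_transpose_nonneg hV (A - B)
  simp only [Matrix.transpose_add, Matrix.transpose_sub, Matrix.add_mul, Matrix.mul_add,
    Matrix.sub_mul, Matrix.mul_sub, Matrix.trace_add, Matrix.trace_sub] at h ⊢
  linarith

theorem trace_mul_mul_transpose_le {V : Matrix (Fin N) (Fin N) ℝ} {c : ℝ}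
    (hV : ∀ i j, |V i j| ≤ c) (A : Matrix (Fin N) (Fin N) ℝ) :
    (A * V * Aᵀ).trace ≤ ∑ i, ∑ j, N * c * A i j ^ 2 := by
  have key : ∀ i j k, A i j * V j k * A i k ≤ c / 2 * A i j ^ 2 + c / 2 * A i k ^ 2 := by
    intro i j k
    have hc : 0 ≤ c := (abs_nonneg _).trans (hV j k)
    have h1 : A i j * V j k * A i k ≤ |A i j| * c * |A i k| := by
      refine (le_abs_self _).trans ?_
      rw [abs_mul, abs_mul]
      gcongr
      exact hV j k
    have h2 := mul_nonneg hc (sq_nonneg (|A i j| - |A i k|))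
    rw [← sq_abs (A i j), ← sq_abs (A i k)]
    nlinarith
  calc (A * V * Aᵀ).trace = ∑ i, ∑ k, ∑ j, A i j * V j k * A i k := by
        simp [Matrix.trace, Matrix.mul_apply, Finset.sum_mul]
    _ ≤ ∑ i, ∑ k, ∑ j, (c / 2 * A i j ^ 2 + c / 2 * A i k ^ 2) :=
        Finset.sum_le_sum fun i _ => Finset.sum_le_sum fun k _ => Finset.sum_le_sum fun j _ =>
          key i j k
    _ = ∑ i, ∑ j, N * c * A i j ^ 2 := by
        refine Finset.sum_congr rfl fun i _ => ?_
        simp only [Finset.sum_add_distrib, Finset.sum_const, Finset.card_univ, Fintype.card_fin,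
          ← Finset.mul_sum, nsmul_eq_mul]
        ring

/-! ### Density of the matrix polynomials -/

theorem normSq_add_le {W : ℝ → Matrix (Fin N) (Fin N) ℝ} (hW : ∀ t, (W t).PosSemidef)
    (hWm : ∀ i j, Measurable fun t => W t i j) {f g : ℝ → Matrix (Fin N) (Fin N) ℝ}
    (hf : ∀ i j, Measurable fun t => f t i j) :
    normSq W (fun t => f t + g t) ≤ 2 * normSq W f + 2 * normSq W g := by
  have hm : Measurable fun t => (2 : ℝ≥0∞) * ENNReal.ofReal (f t * W t * (f t)ᵀ).trace := by
    simp only [Matrix.trace, Matrix.diag_apply, Matrix.mul_apply, Matrix.transpose_apply]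
    fun_prop
  rw [normSq, normSq, normSq, ← lintegral_const_mul' _ _ ENNReal.ofNat_ne_top,
    ← lintegral_const_mul' _ _ ENNReal.ofNat_ne_top, ← lintegral_add_left hm]
  refine lintegral_mono fun t => ?_
  refine (ENNReal.ofReal_le_ofReal (trace_add_mul_mul_transpose_le (hW t) _ _)).trans ?_
  rw [ENNReal.ofReal_add (mul_nonneg two_pos.le (trace_mul_mul_transpose_nonneg (hW t) _))
    (mul_nonneg two_pos.le (trace_mul_mul_transpose_nonneg (hW t) _)),
    ENNReal.ofReal_mul two_pos.le, ENNReal.ofReal_mul two_pos.le, ENNReal.ofReal_ofNat]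

/-- Truncating the coordinates `g = f M⁻¹` of a square integrable function. -/
theorem exists_truncation {W f g : ℝ → Matrix (Fin N) (Fin N) ℝ}
    (hf : normSq W f < ∞) (hfm : ∀ i j, Measurable fun t => f t i j)
    (hWm : ∀ i j, Measurable fun t => W t i j) (hgm : ∀ i j, Measurable fun t => g t i j)
    {ε : ℝ≥0∞} (hε : 0 < ε) :
    ∃ S : Set ℝ, MeasurableSet S ∧ (∃ B : ℝ, ∀ t ∈ S, ∀ i j, |g t i j| ≤ B) ∧
      normSq W (fun t => Sᶜ.indicator f t) < ε := by
  -- These sets increase to the whole line, so the tails of `f` vanish pointwise from some index on,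
  -- and dominated convergence applies.
  let S : ℕ → Set ℝ := fun n => {t | ∀ i j, |g t i j| ≤ n}
  have hS : ∀ n, MeasurableSet (S n) := fun n => by
    have : S n = ⋂ i, ⋂ j, {t | |g t i j| ≤ n} := by ext t; simp [S]
    rw [this]
    exact MeasurableSet.iInter fun i => MeasurableSet.iInter fun j =>
      measurableSet_le (hgm i j).abs measurable_const
  let φ : ℝ → ℝ≥0∞ := fun t => ENNReal.ofReal (f t * W t * (f t)ᵀ).trace
  have hφ : Measurable φ := by
    simp only [φ, Matrix.trace, Matrix.diag_apply, Matrix.mul_apply, Matrix.transpose_apply]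
    fun_prop
  have hn : ∀ n, normSq W (fun t => (S n)ᶜ.indicator f t) = ∫⁻ t, (S n)ᶜ.indicator φ t := by
    intro n
    rw [normSq]
    congr 1 with t
    by_cases ht : t ∈ (S n)ᶜ
    · rw [Set.indicator_of_mem ht, Set.indicator_of_mem ht]
    · rw [Set.indicator_of_notMem ht, Set.indicator_of_notMem ht]; simp
  have hlim : Filter.Tendsto (fun n => ∫⁻ t, (S n)ᶜ.indicator φ t) Filter.atTop
      (nhds (∫⁻ _ : ℝ, 0)) := by
    refine tendsto_lintegral_of_dominated_convergence φ (fun n => hφ.indicator (hS n).compl)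
      (fun n => Filter.Eventually.of_forall fun t => Set.indicator_le_self _ _ _) hf.ne
      (Filter.Eventually.of_forall fun t => ?_)
    obtain ⟨n₀, hn₀⟩ := exists_nat_ge (∑ i, ∑ j, |g t i j|)
    refine tendsto_const_nhds.congr' ?_
    filter_upwards [Filter.eventually_ge_atTop n₀] with n hnn
    have ht : t ∈ S n := fun i j => ?_
    · exact (Set.indicator_of_notMem (Set.notMem_compl_iff.2 ht) _).symm
    have h1 : |g t i j| ≤ ∑ j, |g t i j| :=
      Finset.single_le_sum (f := fun j => |g t i j|) (fun _ _ => abs_nonneg _) (Finset.mem_univ j)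
    have h2 : ∑ j, |g t i j| ≤ ∑ i, ∑ j, |g t i j| :=
      Finset.single_le_sum (f := fun i => ∑ j, |g t i j|)
        (fun _ _ => Finset.sum_nonneg fun _ _ => abs_nonneg _) (Finset.mem_univ i)
    have h3 : (n₀ : ℝ) ≤ n := by exact_mod_cast hnn
    linarith
  rw [lintegral_zero] at hlim
  obtain ⟨n, hn'⟩ := (hlim.eventually_lt_const hε).exists
  exact ⟨S n, hS n, ⟨n, fun t ht => ht⟩, by rw [hn]; exact hn'⟩

/-- If `M W Mᵀ` is dominated by a Gaussian and `M` is invertible on the real line, then the left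
multiples `R M` are dense in `L²(W)`. -/
theorem exists_mul_normSq_sub_lt {W : ℝ → Matrix (Fin N) (Fin N) ℝ}
    (hW : ∀ t, (W t).PosSemidef) (hWm : ∀ i j, Measurable fun t => W t i j) {M : MatPoly N}
    (hM : ∀ t, M.det.eval t ≠ 0) {C : ℝ} (hC : 0 ≤ C)
    (hMW : ∀ t i j, |(evalAt M t * W t * (evalAt M t)ᵀ) i j| ≤ C * Real.exp (-t ^ 2 / 2))
    {f : ℝ → Matrix (Fin N) (Fin N) ℝ} (hf : MemLTwo W f) {ε : ℝ≥0∞} (hε : 0 < ε) :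
    ∃ R : MatPoly N, normSq W (fun t => f t - evalAt (R * M) t) < ε := by
  obtain ⟨hfm, hfi⟩ := hf
  -- `g = f M⁻¹`, with the inverse written through the adjugate so that measurability is evident.
  let g : ℝ → Matrix (Fin N) (Fin N) ℝ :=
    fun t => (M.det.eval t)⁻¹ • (f t * evalAt M.adjugate t)
  have hgm : ∀ i j, Measurable fun t => g t i j := fun i j => by
    simp only [g, Matrix.smul_apply, Matrix.mul_apply, evalAt_apply, smul_eq_mul]
    refine Measurable.mul (by fun_prop) (Finset.measurable_fun_sum _ fun k _ => ?_)
    exact (hfm i k).mul (Polynomial.continuous _).measurable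
  have hgM : ∀ t, g t * evalAt M t = f t := fun t => by
    have h : evalAt M.adjugate t * evalAt M t = M.det.eval t • 1 := by
      rw [← evalAt_mul, Matrix.adjugate_mul, evalAt_smul, evalAt_one]
    rw [Matrix.smul_mul, Matrix.mul_assoc, h, Matrix.mul_smul, Matrix.mul_one,
      inv_smul_smul₀ (hM t)]
  -- There are two errors, and `normSq_add_le` doubles each of them.
  have hε4 : 0 < ε / 4 := ENNReal.div_pos hε.ne' (by norm_num)
  obtain ⟨S, hS, ⟨B, hB⟩, hSε⟩ := exists_truncation hfi hfm hWm hgm hε4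
  -- The truncated coordinates are bounded, hence square integrable for the Gaussian, although `g`
  -- itself need not be.
  let h : ℝ → Matrix (Fin N) (Fin N) ℝ := S.indicator g
  have hhm : ∀ i j, Measurable fun t => h t i j := fun i j => by
    have : (fun t => h t i j) = S.indicator fun t => g t i j := by
      ext t
      by_cases ht : t ∈ S <;> simp [h, ht]
    rw [this]
    exact (hgm i j).indicator hS
  have hhL : ∀ i j, MemLp (fun t => h t i j) 2 (ProbabilityTheory.gaussianReal 0 1) :=
    fun i j => by
    refine MemLp.of_bound (hhm i j).aestronglyMeasurable |B|
      (Filter.Eventually.of_forall fun t => ?_)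
    by_cases ht : t ∈ S
    · simpa [h, ht] using (hB t ht i j).trans (le_abs_self B)
    · simp [h, ht]
  obtain ⟨δ, hδ0, hδ⟩ := ENNReal.exists_nnreal_pos_mul_lt
    (show (N : ℝ≥0∞) * (N * ENNReal.ofReal (N * C)) ≠ ∞ from
      ENNReal.mul_ne_top (ENNReal.natCast_ne_top N)
        (ENNReal.mul_ne_top (ENNReal.natCast_ne_top N) ENNReal.ofReal_ne_top)) hε4.ne'
  have hδ0' : (0 : ℝ≥0∞) < δ := by exact_mod_cast hδ0
  choose q hq using fun i j => exists_polynomial_lintegral_lt (hhL i j) hδ0'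
  let R : MatPoly N := Matrix.of q
  refine ⟨R, ?_⟩
  have h2 : normSq W (fun t => (h t - evalAt R t) * evalAt M t) < ε / 4 := by
    refine lt_of_le_of_lt ?_ hδ
    have hpt : ∀ t, ENNReal.ofReal (((h t - evalAt R t) * evalAt M t) * W t *
        ((h t - evalAt R t) * evalAt M t)ᵀ).trace ≤
        ∑ i, ∑ j, ENNReal.ofReal (N * C) *
          ENNReal.ofReal (Real.exp (-t ^ 2 / 2) * (h t i j - (q i j).eval t) ^ 2) := fun t => by
      have e : ((h t - evalAt R t) * evalAt M t) * W t * ((h t - evalAt R t) * evalAt M t)ᵀ =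
          (h t - evalAt R t) * (evalAt M t * W t * (evalAt M t)ᵀ) * (h t - evalAt R t)ᵀ := by
        rw [Matrix.transpose_mul]; simp only [Matrix.mul_assoc]
      rw [e]
      refine (ENNReal.ofReal_le_ofReal (trace_mul_mul_transpose_le (hMW t) _)).trans ?_
      rw [ENNReal.ofReal_sum_of_nonneg fun i _ => Finset.sum_nonneg fun j _ => by positivity]
      refine Finset.sum_le_sum fun i _ => ?_
      rw [ENNReal.ofReal_sum_of_nonneg fun j _ => by positivity]
      refine Finset.sum_le_sum fun j _ => ?_
      rw [← ENNReal.ofReal_mul (by positivity)]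
      refine ENNReal.ofReal_le_ofReal (le_of_eq ?_)
      simp only [Matrix.sub_apply, evalAt_apply, R, Matrix.of_apply]
      ring
    have hmeas : ∀ i j, Measurable fun t : ℝ => ENNReal.ofReal (N * C) *
        ENNReal.ofReal (Real.exp (-t ^ 2 / 2) * (h t i j - (q i j).eval t) ^ 2) := fun i j => by
      have := hhm i j
      have := (q i j).continuous.measurable
      fun_prop
    calc normSq W (fun t => (h t - evalAt R t) * evalAt M t)
        ≤ ∫⁻ t, ∑ i, ∑ j, ENNReal.ofReal (N * C) *
          ENNReal.ofReal (Real.exp (-t ^ 2 / 2) * (h t i j - (q i j).eval t) ^ 2) :=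
          lintegral_mono hpt
      _ = ∑ i, ∑ j, ENNReal.ofReal (N * C) * ∫⁻ t,
          ENNReal.ofReal (Real.exp (-t ^ 2 / 2) * (h t i j - (q i j).eval t) ^ 2) := by
          rw [lintegral_finsetSum _ fun i _ => Finset.measurable_fun_sum _ fun j _ => hmeas i j]
          refine Finset.sum_congr rfl fun i _ => ?_
          rw [lintegral_finsetSum _ fun j _ => hmeas i j]
          refine Finset.sum_congr rfl fun j _ => ?_
          rw [lintegral_const_mul' _ _ ENNReal.ofReal_ne_top]
      _ ≤ ∑ _i : Fin N, ∑ _j : Fin N, ENNReal.ofReal (N * C) * δ := by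
          gcongr with i _ j _
          exact (hq i j).le
      _ = δ * (N * (N * ENNReal.ofReal (N * C))) := by
          simp only [Finset.sum_const, Finset.card_univ, Fintype.card_fin, nsmul_eq_mul]
          ring
  have hsplit : (fun t => f t - evalAt (R * M) t) =
      fun t => Sᶜ.indicator f t + (h t - evalAt R t) * evalAt M t := by
    funext t
    have : h t * evalAt M t = S.indicator f t := by
      by_cases ht : t ∈ S
      · simp [h, ht, hgM]
      · simp [h, ht]
    rw [evalAt_mul, Matrix.sub_mul, this, ← add_sub_assoc, Set.indicator_compl_add_self_apply]
  have hm1 : ∀ i j, Measurable fun t => (Sᶜ.indicator f t) i j := fun i j => by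
    have : (fun t => Sᶜ.indicator f t i j) = Sᶜ.indicator fun t => f t i j := by
      ext t
      by_cases ht : t ∈ S <;> simp [ht]
    rw [this]
    exact (hfm i j).indicator hS.compl
  rw [hsplit]
  refine (normSq_add_le hW hWm hm1).trans_lt ?_
  rw [← mul_add]
  calc 2 * (normSq W (fun t => Sᶜ.indicator f t)
        + normSq W (fun t => (h t - evalAt R t) * evalAt M t)) < 2 * (ε / 4 + ε / 4) := by
        refine (ENNReal.mul_lt_mul_iff_right two_ne_zero ENNReal.ofNat_ne_top).2
          (ENNReal.add_lt_add hSε h2)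
    _ ≤ ε := by
        rw [← two_mul, ← mul_assoc, ENNReal.div_eq_inv_mul, ← mul_assoc]
        norm_num
        rw [ENNReal.mul_inv_cancel (by norm_num) (by norm_num), one_mul]

/-! ### Spans -/

theorem const_mul_apply_coeff (B : Matrix (Fin N) (Fin N) ℝ) (P : MatPoly N) (m : ℕ) :
    (const B * P).map (fun p => p.coeff m) = B * P.map (fun p => p.coeff m) := by
  ext i j
  simp [Matrix.mul_apply, const, Polynomial.finsetSum_coeff]

/-- A family with nonsingular leading coefficients of all degrees spans the matrix polynomials. -/
theorem exists_eq_sum_const_mul {P : ℕ → MatPoly N} (hP : ∀ n, HasDegreeNonsingular (P n) n)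
    (Y : MatPoly N) :
    ∃ (d : ℕ) (A : ℕ → Matrix (Fin N) (Fin N) ℝ), Y = ∑ n ∈ Finset.range d, const (A n) * P n := by
  have key : ∀ (d : ℕ) (Y : MatPoly N), (∀ m, d ≤ m → Y.map (fun p => p.coeff m) = 0) →
      ∃ A : ℕ → Matrix (Fin N) (Fin N) ℝ, Y = ∑ n ∈ Finset.range d, const (A n) * P n := by
    intro d
    induction d with
    | zero =>
      refine fun Y hY => ⟨0, ?_⟩
      rw [Finset.range_zero, Finset.sum_empty]
      ext i j m
      exact congrFun (congrFun (hY m (Nat.zero_le m)) i) j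
    | succ d ih =>
      intro Y hY
      set L := (P d).map (fun p => p.coeff d) with hL
      -- Left multiplication by `B` matches the coefficient of degree `d`, so the remainder has
      -- smaller degree.
      set B := Y.map (fun p => p.coeff d) * L⁻¹ with hB
      obtain ⟨A, hA⟩ := ih (Y - const B * P d) fun m hm => by
        have e : (Y - const B * P d).map (fun p => p.coeff m) =
            Y.map (fun p => p.coeff m) - B * (P d).map (fun p => p.coeff m) := by
          rw [← const_mul_apply_coeff]
          ext i j; simp
        rw [e]
        rcases hm.eq_or_lt with rfl | hlt
        · rw [← hL, hB, Matrix.mul_assoc,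
            Matrix.nonsing_inv_mul _ (isUnit_iff_ne_zero.2 (hP d).2), Matrix.mul_one, sub_self]
        · rw [hY m hlt, zero_sub, neg_eq_zero]
          have : (P d).map (fun p => p.coeff m) = 0 := by
            ext i j
            exact Polynomial.coeff_eq_zero_of_natDegree_lt (((hP d).1 i j).trans_lt hlt)
          rw [this, Matrix.mul_zero]
      refine ⟨Function.update A d B, ?_⟩
      rw [Finset.sum_range_succ, Function.update_self, ← sub_eq_iff_eq_add, hA]
      refine Finset.sum_congr rfl fun n hn => ?_
      rw [Function.update_of_ne (Finset.mem_range.1 hn).ne]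
  refine ⟨Finset.univ.sup (fun i => Finset.univ.sup fun j => (Y i j).natDegree) + 1,
    key _ Y fun m hm => ?_⟩
  ext i j
  refine Polynomial.coeff_eq_zero_of_natDegree_lt (lt_of_lt_of_le (Nat.lt_succ_of_le ?_) hm)
  exact (Finset.le_sup (f := fun j => (Y i j).natDegree) (Finset.mem_univ j)).trans
    (Finset.le_sup (f := fun i => Finset.univ.sup fun j => (Y i j).natDegree) (Finset.mem_univ i))

theorem exists_der_eq (R : MatPoly N) : ∃ U : MatPoly N, der U = R := by
  have h : ∀ q : ℝ[X], ∃ u : ℝ[X], Polynomial.derivative u = q := fun q => by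
    induction q using Polynomial.induction_on' with
    | add p q hp hq =>
      obtain ⟨u, rfl⟩ := hp
      obtain ⟨v, rfl⟩ := hq
      exact ⟨u + v, by simp⟩
    | monomial n c =>
      refine ⟨Polynomial.monomial (n + 1) (c / (n + 1)), ?_⟩
      rw [Polynomial.derivative_monomial, Nat.add_sub_cancel]
      congr 1
      push_cast
      field_simp
  choose u hu using h
  exact ⟨Matrix.of fun i j => u (R i j), by ext1 i j; simp [der_apply, hu]⟩

theorem quasiDarboux_seed_sum {a : ℝ} (ha : 2 < a ^ 2) (s : Finset ℕ)
    (A : ℕ → Matrix (Fin 2) (Fin 2) ℝ) :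
    quasiDarboux (seed a) (∑ n ∈ s, const (A n) * hermitePoly a (1 - a ^ 2) n) =
      ∑ n ∈ s, const (A n) * excPoly a n := by
  induction s using Finset.cons_induction with
  | empty => simp [quasiDarboux]
  | cons n s hn ih =>
    rw [Finset.sum_cons, Finset.sum_cons, ← ih]
    simp only [quasiDarboux_seed ha, excPoly_eq ha, der_add, der_mul, der_const, Matrix.zero_mul,
      zero_add, Matrix.add_mul, Matrix.mul_sub, Matrix.mul_assoc]
    abel

/-- The `P_n` of all degrees span the matrix polynomials and `𝒜` is linear over constant left
factors; the term of index `1` can be dropped because `𝒜` annihilates the seed. -/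
theorem inSpan_quasiDarboux {a : ℝ} (ha : 2 < a ^ 2) (Y : MatPoly 2) :
    InSpan {1} (excPoly a) (quasiDarboux (seed a) Y) := by
  obtain ⟨d, A, rfl⟩ := exists_eq_sum_const_mul (hermitePoly_degree ha) Y
  refine ⟨(Finset.range d).erase 1, A, ?_, ?_⟩
  · simp
  · rw [quasiDarboux_seed_sum ha]
    refine (Finset.sum_erase _ ?_).symm
    rw [excPoly_one ha, Matrix.mul_zero]

/-- With `U' = R`, one has `𝒜(U S) = U' S F + U S' F - U S = R S F`, because `S' F = S`. -/
theorem inSpan_mul {a : ℝ} (ha : 2 < a ^ 2) (R : MatPoly 2) :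
    InSpan {1} (excPoly a) (R * (seed a * darbouxFactor a)) := by
  obtain ⟨U, rfl⟩ := exists_der_eq R
  convert inSpan_quasiDarboux ha (U * seed a) using 1
  rw [quasiDarboux_seed ha, der_mul, Matrix.add_mul, Matrix.mul_assoc U,
    der_seed_mul_darbouxFactor ha, Matrix.mul_assoc]
  abel

theorem det_darbouxFactor {a : ℝ} (ha : 2 < a ^ 2) (t : ℝ) :
    (darbouxFactor a).det.eval t ≠ 0 := by
  have hc : 0 < a ^ 2 - 2 := by linarith
  rw [Matrix.det_fin_two]
  simp only [darbouxFactor, Matrix.of_apply, Matrix.cons_val_zero, Matrix.cons_val_one,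
    Matrix.cons_val_fin_one, Polynomial.eval_sub, Polynomial.eval_mul, Polynomial.eval_X,
    Polynomial.eval_C]
  have e : t * t - -(a / 2) * (a / (a ^ 2 - 2)) = t ^ 2 + a ^ 2 / (2 * (a ^ 2 - 2)) := by
    field_simp
    ring
  rw [e]
  have : 0 < a ^ 2 := by linarith
  positivity

theorem excPoly_isComplete {a : ℝ} (ha : 2 < a ^ 2) :
    IsCompleteSystem {1} (excPoly a) (excWeight a) := by
  intro f hf ε hε
  set M := seed a * darbouxFactor a with hM
  have hdet : ∀ t, M.det.eval t ≠ 0 := fun t => by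
    rw [hM, Matrix.det_mul, Polynomial.eval_mul]
    exact mul_ne_zero (pfrak_eval_ne_zero ha t) (det_darbouxFactor ha t)
  choose C hC0 hC using fun i j => exists_abs_eval_mul_exp_le ((M * excNum a * Mᵀ) i j)
  have hMW : ∀ t i j, |(evalAt M t * excWeight a t * (evalAt M t)ᵀ) i j| ≤
      (∑ i, ∑ j, C i j) * Real.exp (-t ^ 2 / 2) := fun t i j => by
    rw [evalAt_mul_excWeight_mul_transpose]
    refine ((abs_div_pfrak_pow_le ha 2 _ t).trans (hC i j t)).trans ?_
    gcongr
    have h1 : C i j ≤ ∑ j, C i j :=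
      Finset.single_le_sum (f := fun j => C i j) (fun _ _ => hC0 _ _) (Finset.mem_univ j)
    exact h1.trans (Finset.single_le_sum (f := fun i => ∑ j, C i j)
      (fun _ _ => Finset.sum_nonneg fun _ _ => hC0 _ _) (Finset.mem_univ i))
  obtain ⟨R, hR⟩ := exists_mul_normSq_sub_lt (fun t => (excWeight_posDef ha t).posSemidef)
    (fun i j => (continuous_excWeight ha i j).measurable) hdet
    (Finset.sum_nonneg fun i _ => Finset.sum_nonneg fun j _ => hC0 i j) hMW hf hε
  exact ⟨R * M, inSpan_mul ha R, hR⟩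

/-! ### Assembly: the exceptional system and its norms -/

theorem excPoly_isExceptional {a : ℝ} (ha : 2 < a ^ 2) :
    IsExceptional {1} (excPoly a) (excWeight a) where
  degree n hn := excPoly_degree ha (by simpa using hn)
  weight := excWeight_isWeightMatrix ha
  orthogonal n _ k _ hnk := by
    rw [form_excPoly ha, form_hermitePoly, if_neg hnk, Matrix.zero_mul]
  norm_posDef n hn := form_excPoly_posDef ha (by simpa using hn)
  complete := excPoly_isComplete ha
  eigen := by
    obtain ⟨F₂, F₁, F₀, h, h'⟩ := exists_eigen_operator ha
    exact ⟨F₂, F₁, F₀, h, fun n _ => h' n⟩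

/-- The Gram matrix of `P_n` is diagonal, so `(n - 1) D` may be moved from its right to its left. -/
theorem form_excPoly_self {a : ℝ} (ha : 2 < a ^ 2) (n : ℕ) :
    form (excWeight a) (excPoly a n) (excPoly a n) =
      (((n : ℝ) - 1) / (2 * (a ^ 2 - 2))) •
        (!![1, 0; 0, -(2 / (a ^ 2 - 2))] *
          form (hermiteWeight a (1 - a ^ 2)) (hermitePoly a (1 - a ^ 2) n)
            (hermitePoly a (1 - a ^ 2) n)) := by
  have hc : a ^ 2 - 2 ≠ 0 := by linarith
  rw [form_excPoly ha, form_hermitePoly, if_pos rfl]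
  ext i j; fin_cases i <;> fin_cases j <;>
    simp [Matrix.mul_apply, Fin.sum_univ_two, eigenDiag]
  all_goals field_simp

end ExcMat
end

theorem theorem5p1 (a : ℝ) (ha : 2 < a ^ 2) :
    (∀ t : ℝ, (ExcMat.pfrak a).eval t ≠ 0) ∧
    (∀ t : ℝ, (ExcMat.excWeight a t).PosDef) ∧
    ExcMat.IsExceptional {1} (ExcMat.excPoly a) (ExcMat.excWeight a) ∧
    (∀ n : ℕ, n ≠ 1 →
      ExcMat.form (ExcMat.excWeight a) (ExcMat.excPoly a n) (ExcMat.excPoly a n) =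
        (((n : ℝ) - 1) / (2 * (a ^ 2 - 2))) •
          (!![1, 0; 0, -(2 / (a ^ 2 - 2))] *
            ExcMat.form (ExcMat.hermiteWeight a (1 - a ^ 2))
              (ExcMat.hermitePoly a (1 - a ^ 2) n) (ExcMat.hermitePoly a (1 - a ^ 2) n))) ∧
    (∀ n : ℕ,
      ExcMat.form (ExcMat.hermiteWeight a (1 - a ^ 2))
          (ExcMat.hermitePoly a (1 - a ^ 2) n) (ExcMat.hermitePoly a (1 - a ^ 2) n) =
        (Real.sqrt Real.pi * 2 ^ n * (n.factorial : ℝ)) •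
          !![(1 - a ^ 2) + a ^ 2 * ((n : ℝ) + 1) / 2, 0;
            0, (1 - a ^ 2) * ((1 - a ^ 2) + a ^ 2 * (n : ℝ) / 2)]) :=
  ⟨fun t => ExcMat.pfrak_eval_ne_zero ha t, fun t => ExcMat.excWeight_posDef ha t,
    ExcMat.excPoly_isExceptional ha, fun n _ => ExcMat.form_excPoly_self ha n,
    fun n => by rw [ExcMat.form_hermitePoly, if_pos rfl]⟩
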